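/- Fix integers $d\ge 3$ and $k\ge 1$, and let $(c_n)$ be a sequence of real numbers with $c_n\to c\in\mathbb{R}$ as $n\to\infty$. Let $H_d(n,m)$ be the random $d$-uniform hypergraph on the vertex set $[n]=\{1,\dots,n\}$ whose edge set is chosen uniformly at random among all sets of $m$ of the $\binom nd$ potential edges ($d$-element subsets of $[n]$), and let $H_d(n,p)$ be the random $d$-uniform hypergraph on $[n]$ in which each potential edge is present with probability $p$, independently of all others. For an integer $j\ge 1$, a hypergraph is called $j$-connected if it has more than $j$ vertices and whenever $j-1$ of its vertices are deleted, along with all edges incident to them, the remaining hypergraph is connected (any two vertices are joined by a walk in which consecutive vertices lie in a common edge); every hypergraph with at least one vertex is called $0$-connected. (i) Let $m=m(n)=\frac{n}{d}\left(\ln n+(k-1)\ln\ln n+c_n\right)$ for all large $n$, rounded to an integer either way (that is, $m(n)$ is an integer at distance less than $1$ from the right-hand side). Then the probability that $H_d(n,m)$ is $(k-1)$-connected but not $(k+1)$-connected tends to $1$, and the probability that $H_d(n,m)$ is $k$-connected tends to $\exp\left(-\frac{e^{-c}}{(k-1)!}\right)$ as $n\to\infty$. (ii) Let $p=p(n)\in[0,1]$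 with $p(n)=(d-1)!\,\frac{\ln n+(k-1)\ln\ln n+c_n}{n^{d-1}}$ for all large $n$. Then the probability that $H_d(n,p)$ is $(k-1)$-connected but not $(k+1)$-connected tends to $1$, and the probability that $H_d(n,p)$ is $k$-connected tends to $\exp\left(-\frac{e^{-c}}{(k-1)!}\right)$ as $n\to\infty$. -/

import Mathlib

namespace Hypergraph

variable {α : Type*}

/-- The hypergraph obtained from `H` by deleting the vertices in `S`, along with all edges that are
incident to at least one of them. -/
def deleteVerts (H : Hypergraph α) (S : Set α) : Hypergraph α where
  vertexSet := H.vertexSet \ S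
  edgeSet := {e | e ∈ H.edgeSet ∧ Disjoint e S}
  subset_vertexSet_of_mem_edgeSet' := fun _ he =>
    Set.subset_sdiff.2 ⟨H.subset_vertexSet_of_mem_edgeSet' he.1, he.2⟩

/-- A hypergraph is connected if it has a vertex and any two of its vertices are joined by a walk,
in which consecutive vertices share an edge. -/
def IsConnected (H : Hypergraph α) : Prop :=
  H.vertexSet.Nonempty ∧
    ∀ x ∈ H.vertexSet, ∀ y ∈ H.vertexSet, Relation.ReflTransGen H.Adj x y

/-- `H` is `k`-(vertex-)connected if it has more than `k` vertices and whenever `k - 1` vertices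
are deleted, along with their incident edges, the remaining hypergraph is connected.
The number of deleted vertices is written `S.card + 1 = k`, so that for `k = 0` the second
condition is empty: every hypergraph with a vertex is `0`-connected. -/
def IsKConnected (H : Hypergraph α) (k : ℕ) : Prop :=
  (k : ℕ∞) < H.vertexSet.encard ∧
    ∀ S : Finset α, (S : Set α) ⊆ H.vertexSet → S.card + 1 = k →
      (H.deleteVerts (S : Set α)).IsConnected

/-- The hypergraph whose vertex set is the whole type and whose edge set is `E`. -/
def ofEdges (E : Set (Set α)) : Hypergraph α where
  vertexSet := Set.univ
  edgeSet := E
  subset_vertexSet_of_mem_edgeSet' := fun e _ => Set.subset_univ e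

/-- Every set of hypergraphs is an event (only finite vertex types are used below). -/
instance : MeasurableSpace (Hypergraph α) := ⊤

end Hypergraph

namespace RandomHypergraph

open MeasureTheory ProbabilityTheory

/-- The potential edges: all sets of `d` vertices of `Fin n`. -/
def potentialEdges (d n : ℕ) : Set (Set (Fin n)) := {e | e.ncard = d}

/-- The law of `H_d(n, m)`: the edge set is uniform among all sets of `m` potential edges
(of which there are some if and only if `m ≤ n.choose d`). -/
noncomputable def uniformModel (d n m : ℕ) : Measure (Hypergraph (Fin n)) :=
  (uniformOn {E : Set (Set (Fin n)) | E ⊆ potentialEdges d n ∧ E.ncard = m}).map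
    Hypergraph.ofEdges

/-- The law of `H_d(n, p)`: each potential edge is present with probability `p`, independently of
all others. -/
noncomputable def binomialModel (d n : ℕ) (p : unitInterval) : Measure (Hypergraph (Fin n)) :=
  (setBernoulli (potentialEdges d n) p).map Hypergraph.ofEdges

end RandomHypergraph

open Filter Topology RandomHypergraph

/-! A `k`-connected hypergraph has minimum degree at least `k` (`le_deg_of_kConn`), and at this
density the converse holds with probability tending to 1. So the limit is that of the probability
that no vertex has degree below `k`.

Put L = ln n + (k - 1) ln ln n + c_n, the asymptotic expected degree. A vertex has degree below k
with probability about e^{-L} (ln n)^{k-1} / (k-1)!, so the expected number of such vertices tends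
to λ = e^{-c} / (k-1)!. Any fixed number of vertices have nearly independent degrees, because edges
containing two of them are rare. Hence every binomial moment tends to λ^r / r!
(`tendsto_lowMoment`), and the Bonferroni inequalities give the probability e^{-λ}
(`tendsto_binProb_minDeg`).

If the minimum degree is at least k but k-connectivity fails, there are a set S of k - 1 vertices
and a set U of u ≤ n/2 vertices such that no edge meets U ∪ S in exactly one vertex, that vertex
being in U. Then a vertex of U has k edges, each containing a second vertex of U ∪ S. This costs a
factor of order ((u + k - 1) L / n)^k, which beats the at most n^{k-1} choices of S by a power of n.
Together with the cost of the missing edges, summing over U gives O(L^k / n)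
(`tendsto_binProb_minDeg_not_kConn`).

Connectivity is monotone in the edge set. The windows for k - 1 and k + 1 differ from the window for
k by ln ln n, so comparison with them settles (k - 1)- and (k + 1)-connectivity. For the uniform
model, c is shifted by ±ε: Chebyshev's inequality places m between typical edge counts of the two
binomial models, and the limit is continuous in the shift (`tendsto_unifProb`). -/

namespace RandomHypergraph

open Finset

/-! ### Random subsets with independent elements. -/

section RandomSubset

variable {ι : Type*}

/-- The expectation of `f E`, where `E` is a random subset of `G` that contains each element of `G`
with probability `p`, independently of all others. -/
noncomputable def binExp (G : Finset ι) (p : ℝ) (f : Finset ι → ℝ) : ℝ :=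
  ∑ E ∈ G.powerset, p ^ #E * (1 - p) ^ (#G - #E) * f E

open Classical in
/-- The probability that the random subset of `G` that contains each element of `G` with probability
`p`, independently of all others, has the property `A`. -/
noncomputable def binProb (G : Finset ι) (p : ℝ) (A : Finset ι → Prop) : ℝ :=
  binExp G p (fun E => if A E then 1 else 0)

theorem binExp_congr {G : Finset ι} {p : ℝ} {f g : Finset ι → ℝ} (h : ∀ E ⊆ G, f E = g E) :
    binExp G p f = binExp G p g :=
  sum_congr rfl fun E hE => by rw [h E (mem_powerset.1 hE)]

theorem binExp_mono {G : Finset ι} {p : ℝ} (h0 : 0 ≤ p) (h1 : p ≤ 1) {f g : Finset ι → ℝ}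
    (h : ∀ E ⊆ G, f E ≤ g E) : binExp G p f ≤ binExp G p g :=
  sum_le_sum fun E hE => mul_le_mul_of_nonneg_left (h E (mem_powerset.1 hE))
    (mul_nonneg (pow_nonneg h0 _) (pow_nonneg (by linarith) _))

theorem binExp_const (G : Finset ι) (p a : ℝ) : binExp G p (fun _ => a) = a := by
  rw [binExp, ← sum_mul, Finset.sum_pow_mul_eq_add_pow]
  simp

theorem binExp_mul_left (G : Finset ι) (p a : ℝ) (f : Finset ι → ℝ) :
    binExp G p (fun E => a * f E) = a * binExp G p f := by
  rw [binExp, binExp, mul_sum]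
  exact sum_congr rfl fun E _ => by ring

theorem binExp_sum {κ : Type*} (G : Finset ι) (p : ℝ) (s : Finset κ) (f : κ → Finset ι → ℝ) :
    binExp G p (fun E => ∑ i ∈ s, f i E) = ∑ i ∈ s, binExp G p (f i) := by
  simp only [binExp, mul_sum]
  exact sum_comm

theorem binExp_sub (G : Finset ι) (p : ℝ) (f g : Finset ι → ℝ) :
    binExp G p (fun E => f E - g E) = binExp G p f - binExp G p g := by
  simp only [binExp, mul_sub, sum_sub_distrib]

theorem binExp_empty (p : ℝ) (f : Finset ι → ℝ) : binExp ∅ p f = f ∅ := by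
  simp [binExp]

/-- Conditioning on whether `e` is chosen; this drives the inductions on the ground set. -/
theorem binExp_insert [DecidableEq ι] {G : Finset ι} {e : ι} (he : e ∉ G) (p : ℝ) (f : Finset ι → ℝ) :
    binExp (insert e G) p f =
      (1 - p) * binExp G p f + p * binExp G p (fun E => f (insert e E)) := by
  rw [binExp, sum_powerset_insert he]
  congr 1
  · rw [binExp, mul_sum]
    refine sum_congr rfl fun E hE => ?_
    have := card_le_card (mem_powerset.1 hE)
    rw [card_insert_of_notMem he, show #G + 1 - #E = #G - #E + 1 by omega, pow_succ]
    ring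
  · rw [binExp, mul_sum]
    refine sum_congr rfl fun E hE => ?_
    have : e ∉ E := fun h => he (mem_powerset.1 hE h)
    rw [card_insert_of_notMem he, card_insert_of_notMem this,
      show #G + 1 - (#E + 1) = #G - #E by omega, pow_succ]
    ring

/-- Disjoint parts of the random set are independent. -/
theorem binExp_union [DecidableEq ι] {G₁ G₂ : Finset ι} (h : Disjoint G₁ G₂) (p : ℝ) (f g : Finset ι → ℝ) :
    binExp (G₁ ∪ G₂) p (fun E => f (E ∩ G₁) * g (E ∩ G₂)) = binExp G₁ p f * binExp G₂ p g := by
  induction G₁ using Finset.induction_on generalizing f with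
  | empty =>
    rw [binExp_empty, ← binExp_mul_left, empty_union]
    exact binExp_congr fun E hE => by rw [inter_empty, inter_eq_left.2 hE]
  | insert e G he ih =>
    obtain ⟨he₂, hG⟩ := disjoint_insert_left.1 h
    have heU : e ∉ G ∪ G₂ := by simp [he, he₂]
    rw [insert_union, binExp_insert heU, binExp_insert he, add_mul, mul_assoc, mul_assoc,
      ← ih hG, ← ih hG]
    congr 2
    · refine binExp_congr fun E hE => ?_
      rw [inter_insert_of_notMem (fun h => heU (hE h))]
    · refine binExp_congr fun E hE => ?_
      rw [← insert_inter_distrib, insert_inter_of_notMem he₂]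

/-- The expectation of an increasing function is increasing in `p`. -/
theorem binExp_mono_param {G : Finset ι} {p q : ℝ} (h0 : 0 ≤ p) (hpq : p ≤ q) (h1 : q ≤ 1)
    {f : Finset ι → ℝ} (hf : Monotone f) : binExp G p f ≤ binExp G q f := by
  classical
  induction G using Finset.induction_on generalizing f with
  | empty => simp [binExp_empty]
  | insert e G he ih =>
    rw [binExp_insert he, binExp_insert he]
    have a := ih hf
    have b := ih (f := fun E => f (insert e E)) fun E F hEF => hf (insert_subset_insert e hEF)
    have c : binExp G q f ≤ binExp G q (fun E => f (insert e E)) :=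
      binExp_mono (h0.trans hpq) h1 fun E _ => hf (subset_insert e E)
    -- Replacing `p` by `q` in the two inner expectations uses the induction hypotheses with weights
    -- `1 - p` and `p`. Changing these weights then gains `q - p` times the difference in `c`.
    nlinarith [mul_le_mul_of_nonneg_left a (sub_nonneg.2 (hpq.trans h1)),
      mul_le_mul_of_nonneg_left b h0, mul_nonneg (sub_nonneg.2 hpq) (sub_nonneg.2 c)]

theorem binExp_card (G : Finset ι) (p : ℝ) (f : ℕ → ℝ) :
    binExp G p (fun E => f #E) =
      ∑ j ∈ range (#G + 1), (#G).choose j * p ^ j * (1 - p) ^ (#G - j) * f j := by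
  rw [binExp, sum_powerset_apply_card (fun j => p ^ j * (1 - p) ^ (#G - j) * f j)]
  exact sum_congr rfl fun j _ => by rw [nsmul_eq_mul]; ring

theorem binProb_mono {G : Finset ι} {p : ℝ} (h0 : 0 ≤ p) (h1 : p ≤ 1) {A B : Finset ι → Prop}
    (h : ∀ E ⊆ G, A E → B E) : binProb G p A ≤ binProb G p B :=
  binExp_mono h0 h1 fun E hE => by
    have := h E hE
    split_ifs <;> first | tauto | norm_num

theorem binProb_congr {G : Finset ι} {p : ℝ} {A B : Finset ι → Prop}
    (h : ∀ E ⊆ G, A E ↔ B E) : binProb G p A = binProb G p B := by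
  classical
  exact binExp_congr fun E hE => by simp only [h E hE]

theorem binProb_nonneg {G : Finset ι} {p : ℝ} (h0 : 0 ≤ p) (h1 : p ≤ 1) (A : Finset ι → Prop) :
    0 ≤ binProb G p A := by
  rw [← binExp_const G p 0]
  exact binExp_mono h0 h1 fun E _ => by split_ifs <;> norm_num

theorem binProb_le_one {G : Finset ι} {p : ℝ} (h0 : 0 ≤ p) (h1 : p ≤ 1) (A : Finset ι → Prop) :
    binProb G p A ≤ 1 := by
  rw [← binExp_const G p 1]
  exact binExp_mono h0 h1 fun E _ => by split_ifs <;> norm_num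

theorem binProb_true (G : Finset ι) (p : ℝ) : binProb G p (fun _ => True) = 1 := by
  simp [binProb, binExp_const]

theorem binProb_not (G : Finset ι) (p : ℝ) (A : Finset ι → Prop) :
    binProb G p (fun E => ¬ A E) = 1 - binProb G p A := by
  conv_rhs => rw [← binExp_const G p 1]
  rw [binProb, binProb, ← binExp_sub]
  exact binExp_congr fun E _ => by split_ifs <;> simp_all

theorem binProb_le_sum {κ : Type*} {G : Finset ι} {p : ℝ} (h0 : 0 ≤ p) (h1 : p ≤ 1)
    (s : Finset κ) {A : Finset ι → Prop} {B : κ → Finset ι → Prop}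
    (h : ∀ E ⊆ G, A E → ∃ i ∈ s, B i E) : binProb G p A ≤ ∑ i ∈ s, binProb G p (B i) := by
  classical
  simp only [binProb]
  rw [← binExp_sum]
  refine binExp_mono h0 h1 fun E hE => ?_
  split_ifs with hA
  · obtain ⟨i, hi, hB⟩ := h E hE hA
    calc (1 : ℝ) = if B i E then 1 else 0 := by rw [if_pos hB]
      _ ≤ ∑ i ∈ s, if B i E then 1 else 0 :=
        single_le_sum (f := fun i => if B i E then (1 : ℝ) else 0)
          (fun j _ => by split_ifs <;> norm_num) hi
  · exact sum_nonneg fun i _ => by split_ifs <;> norm_num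

theorem binProb_le_add {G : Finset ι} {p : ℝ} (h0 : 0 ≤ p) (h1 : p ≤ 1)
    {A B C : Finset ι → Prop} (h : ∀ E ⊆ G, A E → B E ∨ C E) :
    binProb G p A ≤ binProb G p B + binProb G p C := by
  have := binProb_le_sum (A := A) (B := fun b : Bool => if b then B else C) h0 h1 Finset.univ
    fun E hE hA => by
      rcases h E hE hA with hB | hC
      · exact ⟨true, by simp, by simpa using hB⟩
      · exact ⟨false, by simp, by simpa using hC⟩
  simpa using this

theorem binProb_union [DecidableEq ι] {G₁ G₂ : Finset ι} (h : Disjoint G₁ G₂) (p : ℝ) (A B : Finset ι → Prop) :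
    binProb (G₁ ∪ G₂) p (fun E => A (E ∩ G₁) ∧ B (E ∩ G₂)) = binProb G₁ p A * binProb G₂ p B := by
  rw [binProb, binProb, binProb, ← binExp_union h]
  exact binExp_congr fun E _ => by split_ifs <;> simp_all

theorem binProb_inter [DecidableEq ι] {G B : Finset ι} (h : B ⊆ G) (p : ℝ) (A : Finset ι → Prop) :
    binProb G p (fun E => A (E ∩ B)) = binProb B p A := by
  have := binProb_union (disjoint_sdiff (s := B) (t := G)) p A (fun _ => True)
  rw [binProb_true, mul_one, union_sdiff_of_subset h] at this
  simpa using this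

theorem binProb_forall {κ : Type*} [DecidableEq ι] [DecidableEq κ] (S : Finset κ) {G : Finset ι} (p : ℝ)
    (B : κ → Finset ι) (A : κ → Finset ι → Prop) (hB : ∀ i ∈ S, B i ⊆ G)
    (hd : (S : Set κ).PairwiseDisjoint B) :
    binProb G p (fun E => ∀ i ∈ S, A i (E ∩ B i)) = ∏ i ∈ S, binProb (B i) p (A i) := by
  induction S using Finset.induction_on generalizing G with
  | empty => simp [binProb_true]
  | insert j S hj ih =>
    have hjG : B j ⊆ G := hB j (mem_insert_self _ _)
    have hsub : ∀ i ∈ S, B i ⊆ G \ B j := fun i hi => by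
      refine subset_sdiff.2 ⟨hB i (mem_insert_of_mem hi), ?_⟩
      exact hd (by simp [hi]) (by simp) (fun h => hj (h ▸ hi))
    rw [prod_insert hj, ← ih hsub (hd.subset (by simp)), ← binProb_union disjoint_sdiff,
      union_sdiff_of_subset hjG]
    refine binProb_congr fun E _ => ?_
    rw [forall_mem_insert]
    refine and_congr_right fun _ => forall₂_congr fun i hi => ?_
    rw [inter_assoc, inter_eq_right.2 (hsub i hi)]

theorem binProb_eq_empty (G : Finset ι) (p : ℝ) : binProb G p (fun E => E = ∅) = (1 - p) ^ #G := by
  rw [binProb, binExp, sum_eq_single ∅]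
  · simp
  · intro E _ hE; simp [hE]
  · simp

theorem binProb_superset [DecidableEq ι] {G K : Finset ι} (h : K ⊆ G) (p : ℝ) :
    binProb G p (fun E => K ⊆ E) = p ^ #K := by
  have h1 : binProb K p (fun E => E = K) = p ^ #K := by
    rw [binProb, binExp, sum_eq_single K]
    · simp
    · intro E _ hE; simp [hE]
    · simp
  rw [← h1, ← binProb_inter h]
  exact binProb_congr fun E _ => by rw [inter_eq_right]

/-- The probability that at least `k` elements of `F` and none of `X` are chosen. -/
theorem binProb_card_inter_le [DecidableEq ι] {G X F : Finset ι} (hX : X ⊆ G) (hF : F ⊆ G) (hXF : Disjoint X F)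
    {p : ℝ} (h0 : 0 ≤ p) (h1 : p ≤ 1) (k : ℕ) :
    binProb G p (fun E => E ∩ X = ∅ ∧ k ≤ #(E ∩ F)) ≤ (1 - p) ^ #X * (#F * p) ^ k := by
  have e1 : binProb G p (fun E => E ∩ X = ∅ ∧ k ≤ #(E ∩ F)) =
      binProb X p (fun E => E = ∅) * binProb F p (fun E => k ≤ #E) := by
    rw [← binProb_union hXF, ← binProb_inter (union_subset hX hF)]
    refine binProb_congr fun E _ => ?_
    rw [inter_assoc, inter_assoc, inter_eq_right.2 subset_union_left,
      inter_eq_right.2 subset_union_right]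
  rw [e1, binProb_eq_empty]
  refine mul_le_mul_of_nonneg_left ?_ (pow_nonneg (by linarith) _)
  calc binProb F p (fun E => k ≤ #E)
      -- A union bound over the `k`-subsets of `F` that could be entirely chosen.
      ≤ ∑ K ∈ F.powersetCard k, binProb F p (fun E => K ⊆ E) := by
        refine binProb_le_sum h0 h1 _ fun E hE hk => ?_
        obtain ⟨K, hK, hc⟩ := exists_subset_card_eq hk
        exact ⟨K, mem_powersetCard.2 ⟨hK.trans hE, hc⟩, hK⟩
    _ = ∑ K ∈ F.powersetCard k, p ^ k := by
        refine sum_congr rfl fun K hK => ?_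
        rw [binProb_superset (mem_powersetCard.1 hK).1, (mem_powersetCard.1 hK).2]
    _ = (#F).choose k * p ^ k := by rw [sum_const, card_powersetCard, nsmul_eq_mul]
    _ ≤ (#F * p) ^ k := by
        rw [mul_pow]
        exact mul_le_mul_of_nonneg_right (mod_cast Nat.choose_le_pow _ _) (pow_nonneg h0 _)

end RandomSubset

/-! ### Uniform subsets of given size, and comparison with the binomial model. -/

section UniformSubset

variable {ι : Type*}

open Classical in
/-- The probability that a uniformly random `m`-element subset of `G` has the property `A`. -/
noncomputable def unifProb (G : Finset ι) (m : ℕ) (A : Finset ι → Prop) : ℝ :=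
  #{E ∈ G.powersetCard m | A E} / (#G).choose m

theorem unifProb_nonneg (G : Finset ι) (m : ℕ) (A : Finset ι → Prop) : 0 ≤ unifProb G m A := by
  unfold unifProb; positivity

theorem unifProb_le_one (G : Finset ι) (m : ℕ) (A : Finset ι → Prop) : unifProb G m A ≤ 1 := by
  classical
  refine div_le_one_of_le₀ ?_ (Nat.cast_nonneg _)
  rw [← card_powersetCard]
  exact_mod_cast card_filter_le _ _

/-- The random subset with independent elements is uniform given its size. -/
theorem binProb_eq_sum_unifProb (G : Finset ι) (p : ℝ) (A : Finset ι → Prop) :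
    binProb G p A =
      ∑ j ∈ range (#G + 1), (#G).choose j * p ^ j * (1 - p) ^ (#G - j) * unifProb G j A := by
  classical
  rw [binProb, binExp, sum_powerset]
  refine sum_congr rfl fun j hj => ?_
  have hj' : j ≤ #G := Nat.lt_succ_iff.1 (mem_range.1 hj)
  have hpos : ((#G).choose j : ℝ) ≠ 0 := by exact_mod_cast (Nat.choose_pos hj').ne'
  rw [sum_congr rfl (g := fun E => p ^ j * (1 - p) ^ (#G - j) * if A E then 1 else 0)]
  · rw [← mul_sum, sum_boole, unifProb]
    field_simp
  · intro E hE
    rw [(mem_powersetCard.1 hE).2]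

/-- Double counting of pairs `E ⊆ F` of sizes `m` and `m + 1` with `A E`: each `E` has `#G - m`
extensions, all with property `A`, and each `F` contains at most `m + 1` such `E`. -/
theorem unifProb_succ_ge {G : Finset ι} {m : ℕ} (hm : m < #G) {A : Finset ι → Prop}
    (hA : Monotone A) : unifProb G m A ≤ unifProb G (m + 1) A := by
  classical
  have key : #{E ∈ G.powersetCard m | A E} * (#G - m) ≤
      #{E ∈ G.powersetCard (m + 1) | A E} * (m + 1) := by
    refine card_mul_le_card_mul (fun E F => E ⊆ F) (fun E hE => ?_) (fun F hF => ?_)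
    · obtain ⟨hE, hAE⟩ := mem_filter.1 hE
      obtain ⟨hEG, hEc⟩ := mem_powersetCard.1 hE
      rw [← hEc, ← card_sdiff_of_subset hEG]
      refine card_le_card_of_injOn (fun e => insert e E) (fun e he => ?_) ?_
      · obtain ⟨heG, heE⟩ := mem_sdiff.1 he
        simp only [bipartiteAbove, coe_filter, mem_filter, mem_powersetCard, Set.mem_ofPred_eq]
        exact ⟨⟨⟨insert_subset heG hEG, by rw [card_insert_of_notMem heE]⟩,
          hA (subset_insert e E) hAE⟩, subset_insert e E⟩
      · intro e he f hf hef
        have : e ∈ insert f E := by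
          have : insert e E = insert f E := hef
          rw [← this]; exact mem_insert_self e E
        exact (mem_insert.1 this).resolve_right (mem_sdiff.1 he).2
    · obtain ⟨hF, -⟩ := mem_filter.1 hF
      obtain ⟨-, hFc⟩ := mem_powersetCard.1 hF
      calc #(bipartiteBelow (fun E F => E ⊆ F) {E ∈ G.powersetCard m | A E} F)
          ≤ #(F.powersetCard m) := by
            refine card_le_card fun E hE => ?_
            simp only [bipartiteBelow, mem_filter, mem_powersetCard] at hE
            exact mem_powersetCard.2 ⟨hE.2, hE.1.1.2⟩
        _ = m + 1 := by rw [card_powersetCard, hFc, Nat.choose_succ_self_right]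
  have h1 : (0 : ℝ) < (#G).choose m := by exact_mod_cast Nat.choose_pos hm.le
  have h2 : (0 : ℝ) < (#G).choose (m + 1) := by exact_mod_cast Nat.choose_pos hm
  have h3 : ((#G).choose (m + 1) : ℝ) * (m + 1) = (#G).choose m * (#G - m : ℕ) := by
    exact_mod_cast Nat.choose_succ_right_eq (#G) m
  have key' : (#{E ∈ G.powersetCard m | A E} : ℝ) * (#G - m : ℕ) ≤
      #{E ∈ G.powersetCard (m + 1) | A E} * (m + 1) := by exact_mod_cast key
  have h4 : (0 : ℝ) < (#G - m : ℕ) := by exact_mod_cast Nat.sub_pos_of_lt hm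
  rw [unifProb, unifProb, div_le_div_iff₀ h1 h2]
  refine le_of_mul_le_mul_right ?_ (show (0 : ℝ) < m + 1 by positivity)
  rw [mul_assoc, h3]
  nlinarith [mul_le_mul_of_nonneg_left key' h1.le]

theorem unifProb_mono_card {G : Finset ι} {m m' : ℕ} (h : m ≤ m') (hm : m' ≤ #G)
    {A : Finset ι → Prop} (hA : Monotone A) : unifProb G m A ≤ unifProb G m' A := by
  induction m', h using Nat.le_induction with
  | base => exact le_rfl
  | succ j _ ih => exact (ih (by omega)).trans (unifProb_succ_ge (by omega) hA)

/-- The binomial variance, read off from the identity for Bernstein polynomials. -/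
theorem sum_choose_mul_sq_sub (N : ℕ) (p : ℝ) :
    ∑ j ∈ range (N + 1), N.choose j * p ^ j * (1 - p) ^ (N - j) * (N * p - j) ^ 2 =
      N * p * (1 - p) := by
  have := congrArg (Polynomial.eval p) (bernsteinPolynomial.variance ℝ N)
  simp only [Polynomial.eval_finsetSum, bernsteinPolynomial, Polynomial.eval_mul,
    Polynomial.eval_pow, Polynomial.eval_sub, Polynomial.eval_X,
    Polynomial.eval_natCast, Polynomial.eval_one, nsmul_eq_mul] at this
  rw [← this]
  exact sum_congr rfl fun j _ => by ring

theorem sum_choose_mul_affine (N : ℕ) (p a b : ℝ) :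
    ∑ j ∈ range (N + 1), N.choose j * p ^ j * (1 - p) ^ (N - j) * (a + b * (N * p - j) ^ 2) =
      a + b * (N * p * (1 - p)) := by
  have h : ∑ j ∈ range (N + 1), (N.choose j : ℝ) * p ^ j * (1 - p) ^ (N - j) = 1 := by
    have := (add_pow p (1 - p) N).symm
    rw [add_sub_cancel, one_pow] at this
    refine Eq.trans (sum_congr rfl fun j _ => ?_) this
    ring
  calc _ = a * ∑ j ∈ range (N + 1), (N.choose j : ℝ) * p ^ j * (1 - p) ^ (N - j) +
        b * ∑ j ∈ range (N + 1), N.choose j * p ^ j * (1 - p) ^ (N - j) * (N * p - j) ^ 2 := by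
        rw [mul_sum, mul_sum, ← sum_add_distrib]
        exact sum_congr rfl fun j _ => by ring
    _ = _ := by rw [h, sum_choose_mul_sq_sub, mul_one]

/-- Condition on the size `j` of the random set. For `j ≤ m` monotonicity in the size applies. For
`j > m` the size deviates from its mean by more than `t`, and the squared deviation over `t ^ 2`
exceeds 1, as in Chebyshev's inequality. -/
theorem binProb_le_unifProb {G : Finset ι} {p t : ℝ} {m : ℕ} (h0 : 0 ≤ p) (h1 : p ≤ 1)
    (ht : 0 < t) (hm : m ≤ #G) (hmt : #G * p + t ≤ m) {A : Finset ι → Prop} (hA : Monotone A) :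
    binProb G p A ≤ unifProb G m A + #G * p / t ^ 2 := by
  have hp : 0 ≤ (#G : ℝ) * p := by positivity
  calc binProb G p A
      ≤ ∑ j ∈ range (#G + 1), (#G).choose j * p ^ j * (1 - p) ^ (#G - j) *
          (unifProb G m A + (t ^ 2)⁻¹ * (#G * p - j) ^ 2) := by
        rw [binProb_eq_sum_unifProb]
        refine sum_le_sum fun j hj => mul_le_mul_of_nonneg_left ?_
          (mul_nonneg (by positivity) (pow_nonneg (by linarith) _))
        rcases le_or_gt j m with hjm | hjm
        · have := unifProb_mono_card hjm hm hA
          have : 0 ≤ (t ^ 2)⁻¹ * (#G * p - j) ^ 2 := by positivity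
          linarith
        · have hj' : (m : ℝ) < j := by exact_mod_cast hjm
          have h2 : 1 ≤ (t ^ 2)⁻¹ * (#G * p - j) ^ 2 := by
            rw [inv_mul_eq_div, one_le_div (by positivity)]
            nlinarith
          linarith [unifProb_le_one G j A, unifProb_nonneg G m A]
    _ ≤ _ := by
        rw [sum_choose_mul_affine, inv_mul_eq_div]
        exact add_le_add le_rfl (div_le_div_of_nonneg_right
          (mul_le_of_le_one_right hp (by linarith)) (by positivity))

theorem unifProb_le_binProb {G : Finset ι} {p t : ℝ} {m : ℕ} (h0 : 0 ≤ p) (h1 : p ≤ 1)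
    (ht : 0 < t) (hmt : m + t ≤ #G * p) {A : Finset ι → Prop} (hA : Monotone A) :
    unifProb G m A ≤ binProb G p A + #G * p / t ^ 2 := by
  have hp : 0 ≤ (#G : ℝ) * p := by positivity
  have : ∑ j ∈ range (#G + 1), (#G).choose j * p ^ j * (1 - p) ^ (#G - j) *
          (unifProb G m A + -(t ^ 2)⁻¹ * (#G * p - j) ^ 2) ≤ binProb G p A := by
    rw [binProb_eq_sum_unifProb]
    refine sum_le_sum fun j hj => mul_le_mul_of_nonneg_left ?_
      (mul_nonneg (by positivity) (pow_nonneg (by linarith) _))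
    have hjG : j ≤ #G := Nat.lt_succ_iff.1 (mem_range.1 hj)
    rcases le_or_gt m j with hjm | hjm
    · have := unifProb_mono_card hjm hjG hA
      have : 0 ≤ (t ^ 2)⁻¹ * (#G * p - j) ^ 2 := by positivity
      linarith
    · have hj' : (j : ℝ) < m := by exact_mod_cast hjm
      have h2 : 1 ≤ (t ^ 2)⁻¹ * (#G * p - j) ^ 2 := by
        rw [inv_mul_eq_div, one_le_div (by positivity)]
        nlinarith
      linarith [unifProb_le_one G m A, unifProb_nonneg G j A]
  rw [sum_choose_mul_affine] at this
  have h3 : (t ^ 2)⁻¹ * (#G * p * (1 - p)) ≤ #G * p / t ^ 2 := by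
    rw [inv_mul_eq_div]
    exact div_le_div_of_nonneg_right (mul_le_of_le_one_right hp (by linarith)) (by positivity)
  linarith

end UniformSubset

/-! ### The two random hypergraph models as finite sums. -/

section Models

open MeasureTheory ProbabilityTheory

/-- The potential edges on the vertex set `Fin n`, as a finset. -/
def edges (d n : ℕ) : Finset (Finset (Fin n)) := powersetCard d univ

theorem mem_edges {d n : ℕ} {e : Finset (Fin n)} : e ∈ edges d n ↔ #e = d := by
  simp [edges]

theorem card_edges (d n : ℕ) : #(edges d n) = n.choose d := by
  simp [edges]

/-- A finite family of finite sets, as a set of sets. -/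
def asSets {n : ℕ} (E : Finset (Finset (Fin n))) : Set (Set (Fin n)) :=
  (fun e : Finset (Fin n) => (e : Set (Fin n))) '' E

theorem asSets_injective (n : ℕ) : Function.Injective (asSets (n := n)) := fun E F h => by
  have := Set.image_injective.2 (Finset.coe_injective (α := Fin n)) h
  exact Finset.coe_injective this

theorem ncard_asSets {n : ℕ} (E : Finset (Finset (Fin n))) : (asSets E).ncard = #E := by
  rw [asSets, Set.ncard_image_of_injective _ Finset.coe_injective, Set.ncard_coe_finset]

theorem potentialEdges_eq (d n : ℕ) : potentialEdges d n = asSets (edges d n) := by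
  ext e
  simp only [potentialEdges, asSets, Set.mem_ofPred_eq, Set.mem_image, mem_coe, mem_edges]
  constructor
  · intro h
    classical
    exact ⟨e.toFinset, by rw [← Set.ncard_eq_toFinset_card', h], by simp⟩
  · rintro ⟨f, hf, rfl⟩
    rw [Set.ncard_coe_finset, hf]

theorem exists_asSets_of_subset {d n : ℕ} {s : Set (Set (Fin n))} (h : s ⊆ potentialEdges d n) :
    ∃ E ⊆ edges d n, asSets E = s := by
  classical
  rw [potentialEdges_eq] at h
  obtain ⟨t, ht, rfl⟩ := Set.subset_image_iff.1 h
  exact ⟨t.toFinset, by simpa using ht, by simp [asSets]⟩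

theorem asSets_mono {n : ℕ} : Monotone (asSets (n := n)) := fun _ _ h =>
  Set.image_mono (by exact_mod_cast h)

theorem measurable_ofEdges (n : ℕ) :
    Measurable (Hypergraph.ofEdges : Set (Set (Fin n)) → Hypergraph (Fin n)) :=
  measurable_of_finite _

theorem binomialModel_real (d n : ℕ) (p : unitInterval) (Q : Hypergraph (Fin n) → Prop) :
    (binomialModel d n p).real {H | Q H} =
      binProb (edges d n) p (fun E => Q (Hypergraph.ofEdges (asSets E))) := by
  classical
  rw [binomialModel, map_measureReal_apply (measurable_ofEdges n) (by exact trivial)]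
  have h1 : (setBernoulli (potentialEdges d n) p).real
      (Hypergraph.ofEdges ⁻¹' {H | Q H}) =
      (setBernoulli (potentialEdges d n) p).real
        (({E ∈ (edges d n).powerset | Q (Hypergraph.ofEdges (asSets E))}.image asSets :
          Finset (Set (Set (Fin n)))) : Set (Set (Set (Fin n)))) := by
    -- The measure is carried by the subsets of the potential edges, so the event may be restricted
    -- to them.
    rw [measureReal_def, setBernoulli_apply_eq_apply_subsets, ← measureReal_def]
    congr 1
    ext s
    simp only [Set.mem_preimage, Set.mem_ofPred_eq, coe_image, Set.mem_image, coe_filter,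
      mem_powerset]
    constructor
    · rintro ⟨hQ, hs⟩
      obtain ⟨E, hE, rfl⟩ := exists_asSets_of_subset hs
      exact ⟨E, ⟨hE, hQ⟩, rfl⟩
    · rintro ⟨E, ⟨hE, hQ⟩, rfl⟩
      exact ⟨hQ, by rw [potentialEdges_eq]; exact asSets_mono hE⟩
  rw [h1, ← sum_measureReal_singleton, sum_image (asSets_injective n).injOn, binProb, binExp,
    sum_filter]
  refine sum_congr rfl fun E hE => ?_
  have hE := mem_powerset.1 hE
  split_ifs
  · rw [setBernoulli_real_singleton p (by rw [potentialEdges_eq]; exact asSets_mono hE)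
      (Set.toFinite _), Set.ncard_sdiff' (by rw [potentialEdges_eq]; exact asSets_mono hE)
      (Set.toFinite _), potentialEdges_eq, ncard_asSets, ncard_asSets, mul_one]
  · simp

theorem uniformModel_real (d n m : ℕ) (Q : Hypergraph (Fin n) → Prop) :
    (uniformModel d n m).real {H | Q H} =
      unifProb (edges d n) m (fun E => Q (Hypergraph.ofEdges (asSets E))) := by
  classical
  rw [uniformModel, map_measureReal_apply (measurable_ofEdges n) (by exact trivial)]
  have h1 : {E : Set (Set (Fin n)) | E ⊆ potentialEdges d n ∧ E.ncard = m} =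
      (((edges d n).powersetCard m).image asSets : Finset (Set (Set (Fin n)))) := by
    ext s
    simp only [Set.mem_ofPred_eq, coe_image, Set.mem_image, mem_coe, mem_powersetCard]
    constructor
    · rintro ⟨hs, hm⟩
      obtain ⟨E, hE, rfl⟩ := exists_asSets_of_subset hs
      exact ⟨E, ⟨hE, by rw [← ncard_asSets, hm]⟩, rfl⟩
    · rintro ⟨E, ⟨hE, hm⟩, rfl⟩
      exact ⟨by rw [potentialEdges_eq]; exact asSets_mono hE, by rw [ncard_asSets, hm]⟩
  have h2 : (uniformOn {E : Set (Set (Fin n)) | E ⊆ potentialEdges d n ∧ E.ncard = m})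
      (Hypergraph.ofEdges ⁻¹' {H | Q H}) =
      uniformOn (((edges d n).powersetCard m).image asSets : Finset (Set (Set (Fin n))))
        (({E ∈ (edges d n).powersetCard m | Q (Hypergraph.ofEdges (asSets E))}.image asSets :
          Finset (Set (Set (Fin n)))) : Set (Set (Set (Fin n)))) := by
    rw [h1, ← uniformOn_inter_self (Finset.finite_toSet _)]
    congr 1
    ext s
    simp only [Set.mem_inter_iff, Set.mem_preimage, Set.mem_ofPred_eq, coe_image, Set.mem_image,
      coe_filter, mem_coe]
    constructor
    · rintro ⟨⟨E, hE, rfl⟩, hQ⟩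
      exact ⟨E, ⟨hE, hQ⟩, rfl⟩
    · rintro ⟨E, ⟨hE, hQ⟩, rfl⟩
      exact ⟨⟨E, hE, rfl⟩, hQ⟩
  rw [measureReal_def, h2, uniformOn_apply_finset, unifProb, inter_eq_right.2
    (image_subset_image (filter_subset _ _)), card_image_of_injective _ (asSets_injective n),
    card_image_of_injective _ (asSets_injective n), card_powersetCard]
  simp

end Models

/-! ### Connectivity, minimum degree and separating sets. -/

section Connectivity

variable {n : ℕ}

/-- `KConn k E` says that the hypergraph on `Fin n` with edge set `E` is `k`-connected. -/
def KConn (k : ℕ) (E : Finset (Finset (Fin n))) : Prop :=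
  (Hypergraph.ofEdges (asSets E)).IsKConnected k

/-- The number of edges that contain `v`. -/
def deg (E : Finset (Finset (Fin n))) (v : Fin n) : ℕ := #{e ∈ E | v ∈ e}

theorem adj_deleteVerts_iff {E : Finset (Finset (Fin n))} {S : Finset (Fin n)} {x y : Fin n} :
    ((Hypergraph.ofEdges (asSets E)).deleteVerts (S : Set (Fin n))).Adj x y ↔
      ∃ e ∈ E, Disjoint e S ∧ x ∈ e ∧ y ∈ e := by
  simp only [Hypergraph.Adj, Hypergraph.deleteVerts, Hypergraph.ofEdges, asSets]
  constructor
  · rintro ⟨_, ⟨⟨e, he, rfl⟩, hd⟩, hx, hy⟩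
    exact ⟨e, he, by simpa using hd, hx, hy⟩
  · rintro ⟨e, he, hd, hx, hy⟩
    exact ⟨e, ⟨⟨e, he, rfl⟩, by simpa using hd⟩, hx, hy⟩

theorem kConn_iff {k : ℕ} {E : Finset (Finset (Fin n))} :
    KConn k E ↔ k < n ∧ ∀ S : Finset (Fin n), #S + 1 = k →
      ∀ x ∉ S, ∀ y ∉ S,
        Relation.ReflTransGen (fun x y => ∃ e ∈ E, Disjoint e S ∧ x ∈ e ∧ y ∈ e) x y := by
  have hcard : ((k : ℕ∞) < (Hypergraph.ofEdges (asSets E)).vertexSet.encard) ↔ k < n := by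
    simp [Hypergraph.ofEdges, Set.encard_univ]
  have hadj (S : Finset (Fin n)) :
      ((Hypergraph.ofEdges (asSets E)).deleteVerts (S : Set (Fin n))).Adj =
        fun x y => ∃ e ∈ E, Disjoint e S ∧ x ∈ e ∧ y ∈ e := by
    ext x y; exact adj_deleteVerts_iff
  rw [KConn, Hypergraph.IsKConnected, hcard]
  refine and_congr_right fun hk => forall_congr' fun S => ?_
  rw [Hypergraph.IsConnected, hadj]
  have hv : ∀ x, x ∈ ((Hypergraph.ofEdges (asSets E)).deleteVerts (S : Set (Fin n))).vertexSet ↔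
      x ∉ S := fun x => by simp [Hypergraph.deleteVerts, Hypergraph.ofEdges]
  constructor
  · intro h hS x hx y hy
    exact (h (by simp [Hypergraph.ofEdges]) hS).2 x ((hv x).2 hx) y ((hv y).2 hy)
  · intro h _ hS
    refine ⟨?_, fun x hx y hy => h hS x ((hv x).1 hx) y ((hv y).1 hy)⟩
    obtain ⟨x, hx⟩ : ∃ x, x ∉ S := by
      by_contra! hall
      have : #S = n := by rw [eq_univ_iff_forall.2 hall, card_univ, Fintype.card_fin]
      omega
    exact ⟨x, (hv x).2 hx⟩

theorem kConn_mono (k : ℕ) : Monotone (KConn (n := n) k) := fun E F hEF h => by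
  rw [kConn_iff] at h ⊢
  refine ⟨h.1, fun S hS x hx y hy => Relation.ReflTransGen.mono ?_ _ _ (h.2 S hS x hx y hy)⟩
  rintro a b ⟨e, he, h⟩
  exact ⟨e, hEF he, h⟩

theorem kConn_zero (hn : 0 < n) (E : Finset (Finset (Fin n))) : KConn 0 E :=
  kConn_iff.2 ⟨hn, fun S hS => by omega⟩

/-- If `v` lies in fewer than `k` edges, pick from each a vertex other than `v`. Padding these to `k
- 1` vertices other than `v` and deleting them isolates `v`, while `k < n` leaves a further vertex.
-/
theorem le_deg_of_kConn {d k : ℕ} (hd : 2 ≤ d) {E : Finset (Finset (Fin n))}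
    (hE : E ⊆ edges d n) (h : KConn k E) (v : Fin n) : k ≤ deg E v := by
  rw [kConn_iff] at h
  by_contra! hlt
  have : Nonempty (Fin n) := ⟨v⟩
  have hw : ∀ e ∈ E, ∃ w ∈ e, w ≠ v := fun e he =>
    exists_mem_ne (by rw [mem_edges.1 (hE he)]; omega) v
  choose! w hwe hwv using hw
  set T := {e ∈ E | v ∈ e}.image w with hT
  have hTv : T ⊆ univ.erase v := fun x hx => by
    obtain ⟨e, he, rfl⟩ := mem_image.1 hx
    exact mem_erase.2 ⟨hwv e (mem_filter.1 he).1, mem_univ _⟩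
  have hTc : #T ≤ k - 1 := card_image_le.trans (by change deg E v ≤ k - 1; omega)
  obtain ⟨S, hTS, hSv, hSc⟩ := exists_subsuperset_card_eq hTv hTc
    (by rw [card_erase_of_mem (mem_univ v), card_univ, Fintype.card_fin]; omega)
  have hvS : v ∉ S := fun hv => by simpa using hSv hv
  obtain ⟨y, hy⟩ : ∃ y, y ∉ insert v S := by
    by_contra! hall
    have : #(insert v S) = n := by rw [eq_univ_iff_forall.2 hall, card_univ, Fintype.card_fin]
    rw [card_insert_of_notMem hvS] at this
    omega
  obtain ⟨hyv, hyS⟩ := not_or.1 (mem_insert.not.1 hy)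
  rcases (h.2 S (by omega) v hvS y hyS).cases_head with heq | ⟨z, ⟨e, he, hdis, hve, -⟩, -⟩
  · exact hyv heq.symm
  · exact disjoint_left.1 hdis (hwe e he) (hTS (mem_image.2 ⟨e, by simp [he, hve], rfl⟩))

/-- A hypergraph that is not `k`-connected has a separating set of `k - 1` vertices. -/
theorem exists_separation_of_not_kConn {d k : ℕ} (hd : 2 ≤ d) (hkn : k < n)
    {E : Finset (Finset (Fin n))} (hE : E ⊆ edges d n) (h : ¬ KConn k E) :
    ∃ S U : Finset (Fin n), #S + 1 = k ∧ U.Nonempty ∧ Disjoint U S ∧ 2 * #U ≤ n ∧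
      ∀ e ∈ E, Disjoint e S → #(e ∩ U) ≠ 1 := by
  classical
  rw [kConn_iff] at h
  push Not at h
  obtain ⟨S, hS, x, hx, y, hy, hxy⟩ := h hkn
  set R := Relation.ReflTransGen (fun x y => ∃ e ∈ E, Disjoint e S ∧ x ∈ e ∧ y ∈ e) x with hR
  have hclosed : ∀ e ∈ E, Disjoint e S → ∀ a ∈ e, R a → ∀ b ∈ e, R b :=
    fun e he hd a ha hRa b hb => hRa.tail ⟨e, he, hd, ha, hb⟩
  -- A union of components contains every surviving edge that it meets, and such an edge has `d ≥ 2`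
  -- vertices.
  have hone : ∀ (P : Fin n → Prop) (U : Finset (Fin n)), (∀ z, z ∈ U ↔ z ∉ S ∧ P z) →
      (∀ e ∈ E, Disjoint e S → ∀ a ∈ e, P a → ∀ b ∈ e, P b) →
      ∀ e ∈ E, Disjoint e S → #(e ∩ U) ≠ 1 := by
    intro P U hU hP e he hdis hc
    obtain ⟨a, ha⟩ := card_pos.1 (hc ▸ one_pos : 0 < #(e ∩ U))
    obtain ⟨hae, haU⟩ := mem_inter.1 ha
    have : e ∩ U = e := inter_eq_left.2 fun b hb =>
      (hU b).2 ⟨disjoint_left.1 hdis hb, hP e he hdis a hae ((hU a).1 haU).2 b hb⟩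
    rw [this, mem_edges.1 (hE he)] at hc
    omega
  set U₁ : Finset (Fin n) := {z | z ∉ S ∧ R z} with hU₁
  set U₂ : Finset (Fin n) := {z | z ∉ S ∧ ¬ R z} with hU₂
  have hdisj : Disjoint U₁ U₂ := disjoint_left.2 fun z h1 h2 =>
    (mem_filter.1 h2).2.2 (mem_filter.1 h1).2.2
  have hsum : #U₁ + #U₂ ≤ n := by
    rw [← card_union_of_disjoint hdisj]
    simpa using card_le_univ (U₁ ∪ U₂)
  -- Take the smaller of the vertices reachable from `x` and the other surviving vertices.
  rcases le_total (2 * #U₁) n with hle | hle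
  · refine ⟨S, U₁, hS, ⟨x, by simp [hU₁, hx, hR, Relation.ReflTransGen.refl]⟩,
      disjoint_left.2 fun z hz => (mem_filter.1 hz).2.1, hle, ?_⟩
    exact hone R U₁ (by simp [hU₁]) hclosed
  · refine ⟨S, U₂, hS, ⟨y, by simpa [hU₂, hy] using hxy⟩,
      disjoint_left.2 fun z hz => (mem_filter.1 hz).2.1, by omega, ?_⟩
    exact hone (fun z => ¬ R z) U₂ (by simp [hU₂])
      fun e he hdis a ha hRa b hb hRb => hRa (hclosed e he hdis b hb hRb a ha)

end Connectivity

/-! ### Counting edges by their intersection with a vertex set. -/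

section Counting

variable {d n : ℕ}

/-- The potential edges that meet `S` in `v` only. -/
def pinned (d : ℕ) (S : Finset (Fin n)) (v : Fin n) : Finset (Finset (Fin n)) :=
  {e ∈ edges d n | e ∩ S = {v}}

theorem pinned_subset (S : Finset (Fin n)) (v : Fin n) : pinned d S v ⊆ edges d n :=
  filter_subset _ _

theorem mem_of_mem_pinned {S : Finset (Fin n)} {v : Fin n} {e : Finset (Fin n)}
    (h : e ∈ pinned d S v) : v ∈ e := by
  have : v ∈ e ∩ S := by rw [(mem_filter.1 h).2]; exact mem_singleton_self v
  exact (mem_inter.1 this).1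

theorem pairwiseDisjoint_pinned (S T : Finset (Fin n)) :
    (T : Set (Fin n)).PairwiseDisjoint (pinned d S) := fun v _ w _ hvw =>
  disjoint_left.2 fun e he hf => hvw <| by
    have h1 := (mem_filter.1 he).2
    rw [(mem_filter.1 hf).2] at h1
    exact (singleton_injective h1).symm

theorem card_pinned (hd : 1 ≤ d) {S : Finset (Fin n)} {v : Fin n} (hv : v ∈ S) :
    #(pinned d S v) = (n - #S).choose (d - 1) := by
  have h : pinned d S v = (powersetCard (d - 1) Sᶜ).image (insert v) := by
    ext e
    simp only [pinned, mem_filter, mem_edges, mem_image, mem_powersetCard]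
    constructor
    · rintro ⟨hc, he⟩
      have hve : v ∈ e := by
        have : v ∈ e ∩ S := by rw [he]; exact mem_singleton_self v
        exact (mem_inter.1 this).1
      refine ⟨e.erase v, ⟨fun x hx => mem_compl.2 fun hxS => ?_, ?_⟩, insert_erase hve⟩
      · obtain ⟨hxv, hxe⟩ := mem_erase.1 hx
        have : x ∈ e ∩ S := mem_inter.2 ⟨hxe, hxS⟩
        rw [he, mem_singleton] at this
        exact hxv this
      · rw [card_erase_of_mem hve, hc]
    · rintro ⟨f, ⟨hf, hc⟩, rfl⟩
      have hvf : v ∉ f := fun h => mem_compl.1 (hf h) hv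
      refine ⟨by rw [card_insert_of_notMem hvf, hc]; omega, ?_⟩
      have : Disjoint f S := disjoint_left.2 fun x hx => mem_compl.1 (hf hx)
      rw [insert_inter_of_mem hv, disjoint_iff_inter_eq_empty.1 this]
      rfl
  rw [h, card_image_of_injOn, card_powersetCard, card_compl, Fintype.card_fin]
  intro f hf g hg hfg
  have hvf : v ∉ f := fun h => mem_compl.1 ((mem_powersetCard.1 hf).1 h) hv
  have hvg : v ∉ g := fun h => mem_compl.1 ((mem_powersetCard.1 hg).1 h) hv
  rw [← erase_insert hvf, ← erase_insert hvg]
  exact congrArg (fun e => e.erase v) hfg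

theorem card_edges_pair_le (hd : 2 ≤ d) {v w : Fin n} (hvw : v ≠ w) :
    #{e ∈ edges d n | v ∈ e ∧ w ∈ e} ≤ n ^ (d - 2) := by
  have h : {e ∈ edges d n | v ∈ e ∧ w ∈ e} ⊆
      (powersetCard (d - 2) univ).image (fun f => insert v (insert w f)) := by
    intro e he
    obtain ⟨he, hv, hw⟩ := mem_filter.1 he
    have hw' : w ∈ e.erase v := mem_erase.2 ⟨hvw.symm, hw⟩
    refine mem_image.2 ⟨(e.erase v).erase w, mem_powersetCard.2 ⟨subset_univ _, ?_⟩, ?_⟩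
    · rw [card_erase_of_mem hw', card_erase_of_mem hv, mem_edges.1 he]
      omega
    · rw [insert_erase hw', insert_erase hv]
  refine (card_le_card h).trans (card_image_le.trans ?_)
  rw [card_powersetCard, card_univ, Fintype.card_fin]
  exact Nat.choose_le_pow _ _

/-- The potential edges that meet `S` in at least two vertices. -/
def doubled (d : ℕ) (S : Finset (Fin n)) : Finset (Finset (Fin n)) :=
  {e ∈ edges d n | 2 ≤ #(e ∩ S)}

theorem card_doubled_le (hd : 2 ≤ d) (S : Finset (Fin n)) :
    #(doubled d S) ≤ #S ^ 2 * n ^ (d - 2) := by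
  have h : doubled d S ⊆ S.offDiag.biUnion fun x => {e ∈ edges d n | x.1 ∈ e ∧ x.2 ∈ e} := by
    intro e he
    obtain ⟨he, hc⟩ := mem_filter.1 he
    obtain ⟨v, hv, w, hw, hvw⟩ := one_lt_card.1 hc
    rw [mem_inter] at hv hw
    exact mem_biUnion.2 ⟨(v, w), mem_offDiag.2 ⟨hv.2, hw.2, hvw⟩,
      mem_filter.2 ⟨he, hv.1, hw.1⟩⟩
  refine (card_le_card h).trans ((card_biUnion_le_card_mul _ _ (n ^ (d - 2)) fun x hx =>
    card_edges_pair_le hd (mem_offDiag.1 hx).2.2).trans ?_)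
  gcongr
  rw [offDiag_card, sq]
  exact Nat.sub_le _ _

/-- The potential edges that contain `v` and another vertex of `T`. -/
def through (d : ℕ) (T : Finset (Fin n)) (v : Fin n) : Finset (Finset (Fin n)) :=
  {e ∈ edges d n | v ∈ e ∧ ∃ w ∈ T, w ≠ v ∧ w ∈ e}

theorem card_through_le (hd : 2 ≤ d) (T : Finset (Fin n)) (v : Fin n) :
    #(through d T v) ≤ #T * n ^ (d - 2) := by
  have h : through d T v ⊆ (T.erase v).biUnion fun w => {e ∈ edges d n | v ∈ e ∧ w ∈ e} := by
    intro e he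
    obtain ⟨he, hv, w, hw, hwv, hwe⟩ := mem_filter.1 he
    exact mem_biUnion.2 ⟨w, mem_erase.2 ⟨hwv, hw⟩, mem_filter.2 ⟨he, hv, hwe⟩⟩
  refine (card_le_card h).trans ((card_biUnion_le_card_mul _ _ (n ^ (d - 2)) fun w hw =>
    card_edges_pair_le hd (mem_erase.1 hw).1.symm).trans ?_)
  gcongr
  exact erase_subset _ _

end Counting

/-! ### Moments of the number of low-degree vertices, and Bonferroni inequalities. -/

section LowDegree

/-- The probability that a binomial random variable is less than `k`. -/
noncomputable def binLt (N : ℕ) (p : ℝ) (k : ℕ) : ℝ :=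
  ∑ j ∈ range k, N.choose j * p ^ j * (1 - p) ^ (N - j)

theorem binProb_card_lt {ι : Type*} (G : Finset ι) (p : ℝ) (k : ℕ) :
    binProb G p (fun E => #E < k) = binLt #G p k := by
  have h := binExp_card G p (fun j => if j < k then 1 else 0)
  rw [binLt]
  calc binProb G p (fun E => #E < k)
      = ∑ j ∈ range (#G + 1), (#G).choose j * p ^ j * (1 - p) ^ (#G - j) *
          (if j < k then 1 else 0) := by
        rw [← h, binProb]; exact binExp_congr fun E _ => by congr
    _ = ∑ j ∈ range (#G + 1) with j < k, (#G).choose j * p ^ j * (1 - p) ^ (#G - j) := by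
        rw [sum_filter]
        exact sum_congr rfl fun j _ => by split_ifs <;> simp
    _ = _ := by
        refine sum_subset (fun j hj => mem_range.2 (mem_filter.1 hj).2) fun j hj hj' => ?_
        have : #G < j := by
          by_contra! hle
          exact hj' (mem_filter.2 ⟨mem_range.2 (by omega), mem_range.1 hj⟩)
        rw [Nat.choose_eq_zero_of_lt this]
        simp

variable {d n : ℕ}

/-- The edges meeting `S` only in `v` bound the degree of `v` from below, and for different `v`
these families are disjoint, hence independent. -/
theorem binProb_low_le (hd : 1 ≤ d) (S : Finset (Fin n)) {p : ℝ} (h0 : 0 ≤ p) (h1 : p ≤ 1)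
    (k : ℕ) :
    binProb (edges d n) p (fun E => ∀ v ∈ S, deg E v < k) ≤
      binLt ((n - #S).choose (d - 1)) p k ^ #S := by
  calc binProb (edges d n) p (fun E => ∀ v ∈ S, deg E v < k)
      ≤ binProb (edges d n) p (fun E => ∀ v ∈ S, #(E ∩ pinned d S v) < k) := by
        refine binProb_mono h0 h1 fun E _ h v hv => lt_of_le_of_lt (card_le_card ?_) (h v hv)
        intro e he
        obtain ⟨heE, hep⟩ := mem_inter.1 he
        exact mem_filter.2 ⟨heE, mem_of_mem_pinned hep⟩
    _ = ∏ v ∈ S, binProb (pinned d S v) p (fun E => #E < k) :=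
        binProb_forall S p (pinned d S) (fun _ E => #E < k) (fun v _ => pinned_subset S v)
          (pairwiseDisjoint_pinned S S)
    _ = _ := by
        rw [prod_congr rfl fun v hv => by rw [binProb_card_lt, card_pinned hd hv], prod_const]

/-- When no chosen edge meets `S` twice, degrees in `S` count pinned edges only. That event is
independent of the pinned families and accounts for the power of `1 - p`. -/
theorem le_binProb_low (hd : 2 ≤ d) (S : Finset (Fin n)) {p : ℝ} (h0 : 0 ≤ p) (h1 : p ≤ 1)
    (k : ℕ) :
    binLt ((n - #S).choose (d - 1)) p k ^ #S * (1 - p) ^ (#S ^ 2 * n ^ (d - 2)) ≤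
      binProb (edges d n) p (fun E => ∀ v ∈ S, deg E v < k) := by
  have hsub : doubled d S ⊆ edges d n := filter_subset _ _
  have hpin : ∀ v ∈ S, pinned d S v ⊆ edges d n \ doubled d S := fun v _ e he => by
    refine mem_sdiff.2 ⟨pinned_subset S v he, fun h => ?_⟩
    have := (mem_filter.1 h).2
    rw [(mem_filter.1 he).2, card_singleton] at this
    omega
  have hlow : binLt ((n - #S).choose (d - 1)) p k ^ #S =
      binProb (edges d n \ doubled d S) p (fun E => ∀ v ∈ S, #(E ∩ pinned d S v) < k) := by
    rw [binProb_forall S p (pinned d S) (fun _ E => #E < k) hpin (pairwiseDisjoint_pinned S S),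
      prod_congr rfl fun v hv => by rw [binProb_card_lt, card_pinned (by omega) hv], prod_const]
  have hnn : 0 ≤ binLt ((n - #S).choose (d - 1)) p k ^ #S := by
    rw [hlow]; exact binProb_nonneg h0 h1 _
  calc binLt ((n - #S).choose (d - 1)) p k ^ #S * (1 - p) ^ (#S ^ 2 * n ^ (d - 2))
      ≤ binLt ((n - #S).choose (d - 1)) p k ^ #S * (1 - p) ^ #(doubled d S) :=
        mul_le_mul_of_nonneg_left (pow_le_pow_of_le_one (by linarith) (by linarith)
          (card_doubled_le hd S)) hnn
    _ = binProb (edges d n) p (fun E => (∀ v ∈ S, #(E ∩ (edges d n \ doubled d S) ∩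
          pinned d S v) < k) ∧ E ∩ doubled d S = ∅) := by
        rw [hlow, ← binProb_eq_empty, ← binProb_union sdiff_disjoint,
          sdiff_union_of_subset hsub]
    _ ≤ _ := by
        refine binProb_mono h0 h1 fun E hE h v hv => lt_of_le_of_lt (card_le_card ?_) (h.1 v hv)
        intro e he
        obtain ⟨heE, hve⟩ := mem_filter.1 he
        have hd' : e ∉ doubled d S := fun hd' => by
          have : e ∈ E ∩ doubled d S := mem_inter.2 ⟨heE, hd'⟩
          rw [h.2] at this
          exact notMem_empty e this
        refine mem_inter.2 ⟨mem_inter.2 ⟨heE, mem_sdiff.2 ⟨hE heE, hd'⟩⟩,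
          mem_filter.2 ⟨hE heE, ?_⟩⟩
        have hc : #(e ∩ S) < 2 := by
          by_contra! hc
          exact hd' (mem_filter.2 ⟨hE heE, hc⟩)
        have hvi : v ∈ e ∩ S := mem_inter.2 ⟨hve, hv⟩
        have hc' : #(e ∩ S) = 1 := by have := card_pos.2 ⟨v, hvi⟩; omega
        obtain ⟨a, ha⟩ := card_eq_one.1 hc'
        rw [ha, mem_singleton] at hvi
        rw [ha, hvi]

/-- The number of vertices whose degree is less than `k`. -/
def lowCount (k : ℕ) (E : Finset (Finset (Fin n))) : ℕ := #{v | deg E v < k}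

/-- The `r`-th binomial moment of the number of vertices whose degree is less than `k`. -/
noncomputable def lowMoment (d n k : ℕ) (p : ℝ) (r : ℕ) : ℝ :=
  binExp (edges d n) p (fun E => ((lowCount k E).choose r : ℝ))

/-- The binomial coefficient counts the `r`-sets consisting of low-degree vertices. -/
theorem lowMoment_eq (d n k : ℕ) (p : ℝ) (r : ℕ) :
    lowMoment d n k p r = ∑ S ∈ powersetCard r (univ : Finset (Fin n)),
      binProb (edges d n) p (fun E => ∀ v ∈ S, deg E v < k) := by
  simp only [lowMoment, binProb]
  rw [← binExp_sum]
  refine binExp_congr fun E _ => ?_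
  have h : ((lowCount k E).choose r : ℝ) =
      ∑ S ∈ powersetCard r univ, if ∀ v ∈ S, deg E v < k then 1 else 0 := by
    rw [sum_boole, lowCount, ← card_powersetCard]
    congr 2
    ext S
    simp only [mem_powersetCard, mem_filter, subset_iff, mem_univ, true_and]
    tauto
  rw [h]
  exact sum_congr rfl fun S _ => by congr

theorem lowMoment_le (hd : 1 ≤ d) {p : ℝ} (h0 : 0 ≤ p) (h1 : p ≤ 1) (k r : ℕ) :
    lowMoment d n k p r ≤ n.choose r * binLt ((n - r).choose (d - 1)) p k ^ r := by
  rw [lowMoment_eq]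
  refine (sum_le_card_nsmul _ _ (binLt ((n - r).choose (d - 1)) p k ^ r) fun S hS => ?_).trans ?_
  · have := binProb_low_le hd S h0 h1 k
    rwa [(mem_powersetCard.1 hS).2] at this
  · simp

theorem le_lowMoment (hd : 2 ≤ d) {p : ℝ} (h0 : 0 ≤ p) (h1 : p ≤ 1) (k r : ℕ) :
    n.choose r * (binLt ((n - r).choose (d - 1)) p k ^ r * (1 - p) ^ (r ^ 2 * n ^ (d - 2))) ≤
      lowMoment d n k p r := by
  rw [lowMoment_eq]
  refine le_trans ?_ (card_nsmul_le_sum _ _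
    (binLt ((n - r).choose (d - 1)) p k ^ r * (1 - p) ^ (r ^ 2 * n ^ (d - 2))) fun S hS => ?_)
  · simp
  · have := le_binProb_low hd S h0 h1 k
    rwa [(mem_powersetCard.1 hS).2] at this

theorem lowCount_eq_zero_iff {k : ℕ} {E : Finset (Finset (Fin n))} :
    lowCount k E = 0 ↔ ∀ v, k ≤ deg E v := by
  simp [lowCount, filter_eq_empty_iff]

/-- The pointwise form of the Bonferroni inequalities: the truncation error has the sign of `(-1) ^
R`, so even `R` gives upper bounds for the indicator of `x = 0` and odd `R` lower bounds. -/
theorem sum_neg_one_pow_mul_choose (x R : ℕ) :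
    ∑ r ∈ range (R + 1), (-1 : ℝ) ^ r * x.choose r =
      if x = 0 then 1 else (-1) ^ R * ((x - 1).choose R : ℝ) := by
  rcases x with _ | x
  · rw [if_pos rfl, sum_range_succ', sum_eq_zero] <;> simp
  · rw [if_neg (Nat.succ_ne_zero x), Nat.add_sub_cancel]
    exact_mod_cast Int.alternating_sum_range_choose_eq_choose (n := x) (m := R)

theorem sum_lowMoment (d n k : ℕ) (p : ℝ) (R : ℕ) :
    ∑ r ∈ range (R + 1), (-1 : ℝ) ^ r * lowMoment d n k p r =
      binExp (edges d n) p (fun E => if lowCount k E = 0 then 1 else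
        (-1) ^ R * ((lowCount k E - 1).choose R : ℝ)) := by
  simp only [lowMoment, ← binExp_mul_left]
  rw [← binExp_sum]
  exact binExp_congr fun E _ => sum_neg_one_pow_mul_choose _ _

theorem binProb_minDeg_le {p : ℝ} (h0 : 0 ≤ p) (h1 : p ≤ 1) (k R : ℕ) :
    binProb (edges d n) p (fun E => ∀ v, k ≤ deg E v) ≤
      ∑ r ∈ range (2 * R + 1), (-1 : ℝ) ^ r * lowMoment d n k p r := by
  rw [sum_lowMoment, binProb]
  refine binExp_mono h0 h1 fun E _ => ?_
  simp only [← lowCount_eq_zero_iff]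
  split_ifs
  · exact le_rfl
  · rw [pow_mul]; simp

theorem le_binProb_minDeg {p : ℝ} (h0 : 0 ≤ p) (h1 : p ≤ 1) (k R : ℕ) :
    ∑ r ∈ range (2 * R + 1 + 1), (-1 : ℝ) ^ r * lowMoment d n k p r ≤
      binProb (edges d n) p (fun E => ∀ v, k ≤ deg E v) := by
  rw [sum_lowMoment, binProb]
  refine binExp_mono h0 h1 fun E _ => ?_
  simp only [← lowCount_eq_zero_iff]
  split_ifs
  · exact le_rfl
  · rw [pow_succ, pow_mul]; simp

/-- Convergence of all binomial moments to those of a Poisson distribution implies convergence of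
the probability of zero. -/
theorem tendsto_exp_of_alternating_bounds {P : ℕ → ℝ} {M : ℕ → ℕ → ℝ} {l : ℝ}
    (hM : ∀ r, Tendsto (fun n => M n r) atTop (𝓝 (l ^ r / r.factorial)))
    (hup : ∀ R n, P n ≤ ∑ r ∈ range (2 * R + 1), (-1 : ℝ) ^ r * M n r)
    (hlo : ∀ R n, ∑ r ∈ range (2 * R + 1 + 1), (-1 : ℝ) ^ r * M n r ≤ P n) :
    Tendsto P atTop (𝓝 (Real.exp (-l))) := by
  have hs : Tendsto (fun N => ∑ r ∈ range N, (-1 : ℝ) ^ r * (l ^ r / r.factorial)) atTop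
      (𝓝 (Real.exp (-l))) := by
    have := (NormedSpace.expSeries_div_hasSum_exp (-l : ℝ)).tendsto_sum_nat
    rw [← Real.exp_eq_exp_ℝ] at this
    refine this.congr fun N => sum_congr rfl fun r _ => ?_
    rw [neg_pow]; ring
  have hlim : ∀ N, Tendsto (fun n => ∑ r ∈ range N, (-1 : ℝ) ^ r * M n r) atTop
      (𝓝 (∑ r ∈ range N, (-1 : ℝ) ^ r * (l ^ r / r.factorial))) := fun N =>
    tendsto_finsetSum _ fun r _ => (hM r).const_mul _
  -- The truncation `R` is fixed first, from the exponential series; only then does `n` tend to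
  -- infinity.
  refine tendsto_order.2 ⟨fun a ha => ?_, fun a ha => ?_⟩
  · have h2 : Tendsto (fun R : ℕ => 2 * R + 1 + 1) atTop atTop :=
      tendsto_atTop_mono (fun R => by rw [id]; omega) tendsto_id
    obtain ⟨R, hR⟩ := ((hs.comp h2).eventually (lt_mem_nhds ha)).exists
    filter_upwards [(hlim _).eventually (lt_mem_nhds hR)] with n hn
    exact hn.trans_le (hlo R n)
  · have h2 : Tendsto (fun R : ℕ => 2 * R + 1) atTop atTop :=
      tendsto_atTop_mono (fun R => by rw [id]; omega) tendsto_id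
    obtain ⟨R, hR⟩ := ((hs.comp h2).eventually (gt_mem_nhds ha)).exists
    filter_upwards [(hlim _).eventually (gt_mem_nhds hR)] with n hn
    exact (hup R n).trans_lt hn

end LowDegree

/-! ### Union bound over separated vertex sets. -/

section Separation

variable {d n : ℕ}

/-- Every edge meeting `U ∪ S` in a single vertex of `U` is absent. So for a fixed `v` in `U`, all
its `k` or more edges contain another vertex of `U ∪ S`. The two families of potential edges are
disjoint, whence a product. -/
theorem binProb_separated_le (hd : 2 ≤ d) {S U : Finset (Fin n)} (hU : U.Nonempty)
    (hUS : Disjoint U S) {p : ℝ} (h0 : 0 ≤ p) (h1 : p ≤ 1) (k : ℕ) :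
    binProb (edges d n) p (fun E => (∀ v, k ≤ deg E v) ∧
        ∀ e ∈ E, Disjoint e S → #(e ∩ U) ≠ 1) ≤
      (1 - p) ^ (#U * (n - (#U + #S)).choose (d - 1)) * ((#U + #S) * n ^ (d - 2) * p) ^ k := by
  obtain ⟨v, hv⟩ := hU
  have hcard : #(U ∪ S) = #U + #S := card_union_of_disjoint hUS
  have hXc : #(U.biUnion (pinned d (U ∪ S))) = #U * (n - (#U + #S)).choose (d - 1) := by
    rw [card_biUnion (fun a ha b hb hab => pairwiseDisjoint_pinned (U ∪ S) U ha hb hab),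
      sum_congr rfl fun w hw => card_pinned (by omega) (mem_union_left S hw), sum_const, hcard,
      smul_eq_mul]
  have hX : U.biUnion (pinned d (U ∪ S)) ⊆ edges d n :=
    biUnion_subset.2 fun w _ => pinned_subset _ _
  have hF : through d (U ∪ S) v ⊆ edges d n := filter_subset _ _
  have hXF : Disjoint (U.biUnion (pinned d (U ∪ S))) (through d (U ∪ S) v) := by
    refine disjoint_left.2 fun e he hf => ?_
    obtain ⟨w, hw, hew⟩ := mem_biUnion.1 he
    obtain ⟨-, hve, w', hw', hne, hwe⟩ := mem_filter.1 hf
    have a : v ∈ e ∩ (U ∪ S) := mem_inter.2 ⟨hve, mem_union_left S hv⟩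
    have b : w' ∈ e ∩ (U ∪ S) := mem_inter.2 ⟨hwe, hw'⟩
    rw [(mem_filter.1 hew).2, mem_singleton] at a b
    exact hne (b.trans a.symm)
  have hFc : (#(through d (U ∪ S) v) : ℝ) ≤ (#U + #S) * n ^ (d - 2) := by
    have := card_through_le hd (U ∪ S) v
    rw [hcard] at this
    exact_mod_cast this
  calc _ ≤ binProb (edges d n) p (fun E => E ∩ U.biUnion (pinned d (U ∪ S)) = ∅ ∧
          k ≤ #(E ∩ through d (U ∪ S) v)) := by
        refine binProb_mono h0 h1 fun E hE ⟨hdeg, hsep⟩ => ?_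
        have hemp : E ∩ U.biUnion (pinned d (U ∪ S)) = ∅ := by
          refine eq_empty_of_forall_notMem fun e he => ?_
          obtain ⟨heE, heX⟩ := mem_inter.1 he
          obtain ⟨w, hw, hew⟩ := mem_biUnion.1 heX
          have hew' := (mem_filter.1 hew).2
          refine hsep e heE (disjoint_left.2 fun x hxe hxS => ?_) ?_
          · have : x ∈ e ∩ (U ∪ S) := mem_inter.2 ⟨hxe, mem_union_right U hxS⟩
            rw [hew', mem_singleton] at this
            exact disjoint_left.1 hUS hw (this ▸ hxS)
          · have : e ∩ U = {w} := by
              refine subset_antisymm ?_ ?_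
              · rw [← hew']; exact inter_subset_inter le_rfl subset_union_left
              · exact singleton_subset_iff.2 (mem_inter.2 ⟨mem_of_mem_pinned hew, hw⟩)
            rw [this, card_singleton]
        refine ⟨hemp, (hdeg v).trans (card_le_card fun e he => ?_)⟩
        obtain ⟨heE, hve⟩ := mem_filter.1 he
        refine mem_inter.2 ⟨heE, mem_filter.2 ⟨hE heE, hve, ?_⟩⟩
        by_contra! hno
        have hpin : e ∈ pinned d (U ∪ S) v := by
          refine mem_filter.2 ⟨hE heE, ?_⟩
          ext x
          simp only [mem_inter, mem_singleton]
          constructor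
          · rintro ⟨hxe, hxT⟩
            by_contra hxv
            exact hno x hxT hxv hxe
          · rintro rfl
            exact ⟨hve, mem_union_left S hv⟩
        have : e ∈ E ∩ U.biUnion (pinned d (U ∪ S)) :=
          mem_inter.2 ⟨heE, mem_biUnion.2 ⟨v, hv, hpin⟩⟩
        rw [hemp] at this
        exact notMem_empty e this
    _ ≤ (1 - p) ^ #(U.biUnion (pinned d (U ∪ S))) * (#(through d (U ∪ S) v) * p) ^ k :=
        binProb_card_inter_le hX hF hXF h0 h1 k
    _ ≤ _ := by
        rw [hXc]
        refine mul_le_mul_of_nonneg_left ?_ (pow_nonneg (by linarith) _)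
        gcongr

theorem binProb_minDeg_not_kConn_le (hd : 2 ≤ d) {k : ℕ} (hkn : k < n) {p : ℝ} (h0 : 0 ≤ p)
    (h1 : p ≤ 1) :
    binProb (edges d n) p (fun E => (∀ v, k ≤ deg E v) ∧ ¬ KConn k E) ≤
      ∑ u ∈ Icc 1 (n / 2), (n : ℝ) ^ (k - 1) * (n.choose u *
        ((1 - p) ^ (u * (n - (u + (k - 1))).choose (d - 1)) *
          ((u + (k - 1 : ℕ)) * n ^ (d - 2) * p) ^ k)) := by
  set Bad : Finset (Fin n) → Finset (Fin n) → Finset (Finset (Fin n)) → Prop := fun S U E =>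
    Disjoint U S ∧ (∀ v, k ≤ deg E v) ∧ ∀ e ∈ E, Disjoint e S → #(e ∩ U) ≠ 1 with hBad
  have hS : ∀ u, ∑ S ∈ powersetCard (k - 1) (univ : Finset (Fin n)), (n.choose u *
        ((1 - p) ^ (u * (n - (u + (k - 1))).choose (d - 1)) *
          ((u + (k - 1 : ℕ)) * n ^ (d - 2) * p) ^ k)) ≤ (n : ℝ) ^ (k - 1) * (n.choose u *
        ((1 - p) ^ (u * (n - (u + (k - 1))).choose (d - 1)) *
          ((u + (k - 1 : ℕ)) * n ^ (d - 2) * p) ^ k)) := fun u => by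
    rw [sum_const, card_powersetCard, card_univ, Fintype.card_fin, nsmul_eq_mul]
    refine mul_le_mul_of_nonneg_right (mod_cast Nat.choose_le_pow _ _) ?_
    have : 0 ≤ 1 - p := by linarith
    positivity
  calc _ ≤ ∑ u ∈ Icc 1 (n / 2), binProb (edges d n) p (fun E =>
          ∃ S ∈ powersetCard (k - 1) (univ : Finset (Fin n)),
            ∃ U ∈ powersetCard u (univ : Finset (Fin n)), Bad S U E) := by
        refine binProb_le_sum h0 h1 _ fun E hE ⟨hdeg, hconn⟩ => ?_
        obtain ⟨S, U, hSc, hU, hUS, hUc, hsep⟩ := exists_separation_of_not_kConn hd hkn hE hconn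
        have := card_pos.2 hU
        exact ⟨#U, mem_Icc.2 ⟨by omega, by omega⟩, S, mem_powersetCard.2 ⟨subset_univ _, by omega⟩,
          U, mem_powersetCard.2 ⟨subset_univ _, rfl⟩, hUS, hdeg, hsep⟩
    _ ≤ _ := by
        refine sum_le_sum fun u hu => le_trans ?_ (hS u)
        refine (binProb_le_sum h0 h1 _ fun E _ h => h).trans (sum_le_sum fun S hSm => ?_)
        refine (binProb_le_sum h0 h1 _ fun E _ h => h).trans ?_
        refine (sum_le_card_nsmul _ _ ((1 - p) ^ (u * (n - (u + (k - 1))).choose (d - 1)) *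
          ((u + (k - 1 : ℕ)) * n ^ (d - 2) * p) ^ k) fun U hUm => ?_).trans ?_
        · have hSc := (mem_powersetCard.1 hSm).2
          have hUc := (mem_powersetCard.1 hUm).2
          by_cases hUS : Disjoint U S
          · have hU : U.Nonempty := card_pos.1 (by rw [hUc]; exact (mem_Icc.1 hu).1)
            have := binProb_separated_le hd hU hUS h0 h1 k
            rw [hSc, hUc] at this
            exact (binProb_mono h0 h1 fun E _ h => h.2).trans this
          -- Pairs that intersect are admitted in the sum but contribute probability zero.
          · have hle : binProb (edges d n) p (Bad S U) ≤ binProb (edges d n) p (fun _ => ¬ True) :=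
              binProb_mono h0 h1 fun E _ h => absurd h.1 hUS
            rw [binProb_not, binProb_true, sub_self] at hle
            refine hle.trans ?_
            have : 0 ≤ 1 - p := by linarith
            positivity
        · rw [card_powersetCard, card_univ, Fintype.card_fin, nsmul_eq_mul]

end Separation

/-! ### Asymptotics of the threshold function. -/

section Threshold

/-- The expected degree at the threshold for `k`-connectivity. -/
noncomputable def thr (k : ℕ) (c : ℕ → ℝ) (n : ℕ) : ℝ :=
  Real.log n + ((k : ℝ) - 1) * Real.log (Real.log n) + c n

theorem tendsto_log_natCast : Tendsto (fun n : ℕ => Real.log n) atTop atTop :=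
  Real.tendsto_log_atTop.comp tendsto_natCast_atTop_atTop

theorem tendsto_thr_div_log (k : ℕ) {c : ℕ → ℝ} {c₀ : ℝ} (hc : Tendsto c atTop (𝓝 c₀)) :
    Tendsto (fun n => thr k c n / Real.log n) atTop (𝓝 1) := by
  have h1 : Tendsto (fun n : ℕ => Real.log (Real.log n) / Real.log n) atTop (𝓝 0) :=
    Real.isLittleO_log_id_atTop.tendsto_div_nhds_zero.comp tendsto_log_natCast
  have h2 : Tendsto (fun n : ℕ => c n / Real.log n) atTop (𝓝 0) :=
    hc.div_atTop tendsto_log_natCast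
  have h3 : Tendsto (fun n : ℕ => 1 + ((k : ℝ) - 1) * (Real.log (Real.log n) / Real.log n) +
      c n / Real.log n) atTop (𝓝 (1 + ((k : ℝ) - 1) * 0 + 0)) :=
    (tendsto_const_nhds.add (h1.const_mul _)).add h2
  rw [mul_zero, add_zero, add_zero] at h3
  refine h3.congr' ?_
  filter_upwards [tendsto_log_natCast.eventually_gt_atTop 0] with n hn
  rw [thr]
  field_simp

theorem tendsto_thr_atTop (k : ℕ) {c : ℕ → ℝ} {c₀ : ℝ} (hc : Tendsto c atTop (𝓝 c₀)) :
    Tendsto (thr k c) atTop atTop := by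
  refine ((tendsto_thr_div_log k hc).pos_mul_atTop one_pos tendsto_log_natCast).congr' ?_
  filter_upwards [tendsto_log_natCast.eventually_gt_atTop 0] with n hn
  field_simp

theorem tendsto_thr_pow_div (k : ℕ) {c : ℕ → ℝ} {c₀ : ℝ} (hc : Tendsto c atTop (𝓝 c₀)) (j : ℕ) :
    Tendsto (fun n : ℕ => thr k c n ^ j / n) atTop (𝓝 0) := by
  have h1 : Tendsto (fun n : ℕ => Real.log n ^ j / n) atTop (𝓝 0) :=
    (Real.isLittleO_pow_log_id_atTop (n := j)).tendsto_div_nhds_zero.comp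
      tendsto_natCast_atTop_atTop
  have h2 := ((tendsto_thr_div_log k hc).pow j).mul h1
  rw [mul_zero] at h2
  refine h2.congr' ?_
  filter_upwards [tendsto_log_natCast.eventually_gt_atTop 0] with n hn
  rw [div_pow]
  field_simp

theorem tendsto_thr_div (k : ℕ) {c : ℕ → ℝ} {c₀ : ℝ} (hc : Tendsto c atTop (𝓝 c₀)) :
    Tendsto (fun n : ℕ => thr k c n / n) atTop (𝓝 0) := by
  simpa using tendsto_thr_pow_div k hc 1

theorem tendsto_thr_div_rpow (k : ℕ) {c : ℕ → ℝ} {c₀ : ℝ} (hc : Tendsto c atTop (𝓝 c₀)) {a : ℝ}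
    (ha : 0 < a) : Tendsto (fun n : ℕ => thr k c n / (n : ℝ) ^ a) atTop (𝓝 0) := by
  have h1 : Tendsto (fun n : ℕ => Real.log n / (n : ℝ) ^ a) atTop (𝓝 0) :=
    (isLittleO_log_rpow_atTop ha).tendsto_div_nhds_zero.comp tendsto_natCast_atTop_atTop
  have h2 := (tendsto_thr_div_log k hc).mul h1
  rw [mul_zero] at h2
  refine h2.congr' ?_
  filter_upwards [tendsto_log_natCast.eventually_gt_atTop 0] with n hn
  field_simp

/-- The `log log` term of `thr` is exactly what offsets the factor `(log n) ^ (k - 1)` in the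
probability of degree `k - 1`. -/
theorem exp_neg_thr {k : ℕ} (hk : 1 ≤ k) (c : ℕ → ℝ) {n : ℕ} (hn : 0 < Real.log n) :
    n * Real.exp (-thr k c n) * Real.log n ^ (k - 1) = Real.exp (-c n) := by
  have hn0 : (0 : ℝ) < n := by
    rcases Nat.eq_zero_or_pos n with rfl | h
    · simp at hn
    · exact_mod_cast h
  have h1 : Real.log n ^ (k - 1) = Real.exp (((k : ℝ) - 1) * Real.log (Real.log n)) := by
    rw [show (k : ℝ) - 1 = ((k - 1 : ℕ) : ℝ) by rw [Nat.cast_sub hk, Nat.cast_one], ← Real.log_pow,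
      Real.exp_log (by positivity)]
  nth_rewrite 1 [← Real.exp_log hn0]
  rw [h1, ← Real.exp_add, ← Real.exp_add, thr]
  congr 1
  ring

theorem factorial_mul_choose_le (D n x : ℕ) :
    (D.factorial : ℝ) * (n - x).choose D ≤ (n : ℝ) ^ D := by
  rw [← Nat.cast_mul, ← Nat.descFactorial_eq_factorial_mul_choose]
  exact_mod_cast (Nat.descFactorial_le_pow _ _).trans (Nat.pow_le_pow_left (Nat.sub_le n x) D)

theorem le_factorial_mul_choose {D n x : ℕ} (h : x + D ≤ n) :
    ((n : ℝ) - (x + D)) ^ D ≤ (D.factorial : ℝ) * (n - x).choose D := by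
  rw [← Nat.cast_mul, ← Nat.descFactorial_eq_factorial_mul_choose]
  have h1 : (n - (x + D)) ^ D ≤ (n - x).descFactorial D :=
    (Nat.pow_le_pow_left (by omega) D).trans (Nat.pow_sub_le_descFactorial (n - x) D)
  have h2 : ((n - (x + D) : ℕ) : ℝ) = (n : ℝ) - (x + D) := by push_cast [Nat.cast_sub h]; ring
  rw [← h2]
  exact_mod_cast h1

/-- The expected number of chosen elements, when each of `(n - x).choose D` elements is chosen with
probability `D ! * L / n ^ D`, is between `(1 - (x + D) / n) ^ D * L` and `L`. -/
theorem choose_mul_le {D n x : ℕ} (hn : 0 < n) {L : ℝ} (hL : 0 ≤ L) :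
    ((n - x).choose D : ℝ) * (D.factorial * (L / (n : ℝ) ^ D)) ≤ L := by
  have hn' : (0 : ℝ) < n := by exact_mod_cast hn
  calc ((n - x).choose D : ℝ) * (D.factorial * (L / (n : ℝ) ^ D))
      = (D.factorial * (n - x).choose D : ℝ) * (L / (n : ℝ) ^ D) := by ring
    _ ≤ (n : ℝ) ^ D * (L / (n : ℝ) ^ D) := by
        gcongr
        exact factorial_mul_choose_le D n x
    _ = L := by field_simp

theorem le_choose_mul {D n x : ℕ} (hn : 0 < n) (h : x + D ≤ n) {L : ℝ} (hL : 0 ≤ L) :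
    (1 - ((x : ℝ) + D) / n) ^ D * L ≤
      ((n - x).choose D : ℝ) * (D.factorial * (L / (n : ℝ) ^ D)) := by
  have hn' : (0 : ℝ) < n := by exact_mod_cast hn
  calc (1 - ((x : ℝ) + D) / n) ^ D * L = ((n : ℝ) - (x + D)) ^ D * (L / (n : ℝ) ^ D) := by
        rw [show (1 - ((x : ℝ) + D) / n) = ((n : ℝ) - (x + D)) / n by field_simp, div_pow]
        ring
    _ ≤ (D.factorial * (n - x).choose D : ℝ) * (L / (n : ℝ) ^ D) := by
        gcongr
        exact le_factorial_mul_choose h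
    _ = _ := by ring

/-- Linearised by Bernoulli's inequality. This form serves when `x * L` is small against `n`; the
power form still gives a constant fraction of `L` for `x` near `n / 2`. -/
theorem le_choose_mul' {D n x : ℕ} (hn : 0 < n) (h : x + D ≤ n) {L : ℝ} (hL : 0 ≤ L) :
    (1 - D * (((x : ℝ) + D) / n)) * L ≤
      ((n - x).choose D : ℝ) * (D.factorial * (L / (n : ℝ) ^ D)) := by
  refine le_trans (mul_le_mul_of_nonneg_right ?_ hL) (le_choose_mul hn h hL)
  have hn' : (0 : ℝ) < n := by exact_mod_cast hn
  have h' : ((x : ℝ) + D) / n ≤ 1 := by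
    rw [div_le_one hn']; exact_mod_cast h
  have := one_add_mul_le_pow (a := -(((x : ℝ) + D) / n)) (by linarith) D
  rw [← sub_eq_add_neg] at this
  linarith

end Threshold

/-! ### The probability that a vertex has low degree. -/

section LowDegreeLimit

variable {d k : ℕ} {c : ℕ → ℝ} {c₀ : ℝ} {p : ℕ → ℝ}

/-- The edge probability at the threshold for `k`-connectivity. -/
def IsThr (d k : ℕ) (c : ℕ → ℝ) (p : ℕ → ℝ) : Prop :=
  ∀ᶠ n : ℕ in atTop, p n = ((d - 1).factorial : ℝ) * (thr k c n / (n : ℝ) ^ (d - 1))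

theorem tendsto_pow_mul_param (hd : 2 ≤ d) (hc : Tendsto c atTop (𝓝 c₀)) (hp : IsThr d k c p) :
    Tendsto (fun n : ℕ => (n : ℝ) ^ (d - 2) * p n) atTop (𝓝 0) := by
  have h := (tendsto_thr_div k hc).const_mul ((d - 1).factorial : ℝ)
  rw [mul_zero] at h
  refine h.congr' ?_
  filter_upwards [hp, eventually_gt_atTop 0] with n hn hn0
  have hn' : (0 : ℝ) < n := by exact_mod_cast hn0
  rw [hn, show d - 1 = d - 2 + 1 by omega, pow_succ]
  field_simp

theorem tendsto_param (hd : 2 ≤ d) (hc : Tendsto c atTop (𝓝 c₀)) (hp : IsThr d k c p)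
    (h0 : ∀ n, 0 ≤ p n) : Tendsto p atTop (𝓝 0) := by
  refine squeeze_zero' (Eventually.of_forall h0) ?_ (tendsto_pow_mul_param hd hc hp)
  filter_upwards [eventually_gt_atTop 0] with n hn
  have : (1 : ℝ) ≤ (n : ℝ) ^ (d - 2) := one_le_pow₀ (by exact_mod_cast hn)
  nlinarith [h0 n]

/-- The difference, not just the ratio, must be controlled, since it enters an exponent. -/
theorem tendsto_choose_mul_param_sub (hc : Tendsto c atTop (𝓝 c₀)) (hp : IsThr d k c p) (r : ℕ) :
    Tendsto (fun n : ℕ => ((n - r).choose (d - 1) : ℝ) * p n - thr k c n) atTop (𝓝 0) := by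
  have h := (tendsto_thr_div k hc).const_mul (-(((d - 1 : ℕ) : ℝ) * (r + (d - 1 : ℕ))))
  rw [mul_zero] at h
  refine tendsto_of_tendsto_of_tendsto_of_le_of_le' h tendsto_const_nhds ?_ ?_
  · filter_upwards [hp, eventually_gt_atTop 0, eventually_ge_atTop (r + (d - 1)),
      (tendsto_thr_atTop k hc).eventually_ge_atTop 0] with n hn hn0 hnr hL
    have := le_choose_mul' hn0 hnr hL
    rw [← hn] at this
    calc _ = (1 - (d - 1 : ℕ) * (((r : ℝ) + (d - 1 : ℕ)) / n)) * thr k c n - thr k c n := by ring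
      _ ≤ _ := by linarith
  · filter_upwards [hp, eventually_gt_atTop 0,
      (tendsto_thr_atTop k hc).eventually_ge_atTop 0] with n hn hn0 hL
    have := choose_mul_le (D := d - 1) (x := r) hn0 hL
    rw [← hn] at this
    linarith

/-- Writing N for the binomial coefficient, the bounds 1 - 1/(1-p) ≤ ln(1-p) ≤ -p put the logarithm
of (1-p)^N between -Np - Np²/(1-p) and -Np. The shift by `j` costs at most `j * p`. -/
theorem tendsto_one_sub_pow_mul_exp (hd : 2 ≤ d) (hc : Tendsto c atTop (𝓝 c₀))
    (hp : IsThr d k c p) (h0 : ∀ n, 0 ≤ p n) (r j : ℕ) :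
    Tendsto (fun n : ℕ => (1 - p n) ^ ((n - r).choose (d - 1) - j) * Real.exp (thr k c n)) atTop
      (𝓝 1) := by
  have hN := tendsto_choose_mul_param_sub hc hp r
  have hp0 := tendsto_param hd hc hp h0
  have hup : Tendsto (fun n : ℕ => Real.exp (j * p n -
      (((n - r).choose (d - 1) : ℝ) * p n - thr k c n))) atTop (𝓝 1) := by
    have := ((hp0.const_mul (j : ℝ)).sub hN).rexp
    simpa using this
  -- This product is of order `thr ^ 2 / n ^ (d - 1)`, which vanishes for `d ≥ 2`.
  have hNpp : Tendsto (fun n : ℕ => ((n - r).choose (d - 1) : ℝ) * p n * p n) atTop (𝓝 0) := by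
    have h1 : Tendsto (fun n : ℕ => thr k c n * p n) atTop (𝓝 0) := by
      have h2 := ((tendsto_thr_pow_div k hc 2).const_mul ((d - 1).factorial : ℝ))
      rw [mul_zero] at h2
      refine squeeze_zero' ?_ ?_ h2
      · filter_upwards [(tendsto_thr_atTop k hc).eventually_ge_atTop 0] with n hL
        exact mul_nonneg hL (h0 n)
      · filter_upwards [hp, eventually_gt_atTop 0,
          (tendsto_thr_atTop k hc).eventually_ge_atTop 0] with n hn hn0 hL
        have hn1 : (1 : ℝ) ≤ n := by exact_mod_cast hn0
        have : (n : ℝ) ≤ (n : ℝ) ^ (d - 1) := le_self_pow₀ hn1 (by omega)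
        rw [hn]
        calc thr k c n * ((d - 1).factorial * (thr k c n / (n : ℝ) ^ (d - 1)))
            = (d - 1).factorial * (thr k c n ^ 2 / (n : ℝ) ^ (d - 1)) := by ring
          _ ≤ (d - 1).factorial * (thr k c n ^ 2 / n) := by gcongr
    have h3 := (hN.mul hp0).add h1
    simp only [mul_zero, add_zero] at h3
    exact h3.congr fun n => by ring
  have hlo : Tendsto (fun n : ℕ => Real.exp (-(((n - r).choose (d - 1) : ℝ) * p n - thr k c n) -
      ((n - r).choose (d - 1) : ℝ) * p n * p n / (1 - p n))) atTop (𝓝 1) := by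
    have h1 : Tendsto (fun n : ℕ => ((n - r).choose (d - 1) : ℝ) * p n * p n / (1 - p n)) atTop
        (𝓝 (0 / (1 - 0))) := hNpp.div (tendsto_const_nhds.sub hp0) (by norm_num)
    have := (hN.neg.sub h1).rexp
    simpa using this
  have hlt : ∀ᶠ n in atTop, p n < 1 := hp0.eventually (gt_mem_nhds one_pos)
  refine tendsto_of_tendsto_of_tendsto_of_le_of_le' hlo hup ?_ ?_
  · filter_upwards [hlt] with n hn
    set N := (n - r).choose (d - 1)
    have hpos : 0 < 1 - p n := by linarith
    calc _ = Real.exp (N * (1 - (1 - p n)⁻¹)) * Real.exp (thr k c n) := by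
          rw [← Real.exp_add]; congr 1; field_simp; ring
      _ ≤ Real.exp (N * Real.log (1 - p n)) * Real.exp (thr k c n) := by
          gcongr
          exact Real.one_sub_inv_le_log_of_pos hpos
      _ = (1 - p n) ^ N * Real.exp (thr k c n) := by
          rw [← Real.log_pow, Real.exp_log (by positivity)]
      _ ≤ _ := by
          refine mul_le_mul_of_nonneg_right ?_ (Real.exp_nonneg _)
          exact pow_le_pow_of_le_one hpos.le (by linarith [h0 n]) (Nat.sub_le _ _)
  · filter_upwards [hlt] with n hn
    set N := (n - r).choose (d - 1)
    have hpos : 0 < 1 - p n := by linarith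
    have hsub : (N : ℝ) - j ≤ (N - j : ℕ) := by
      rw [sub_le_iff_le_add]; exact_mod_cast (by omega : N ≤ N - j + j)
    calc (1 - p n) ^ (N - j) * Real.exp (thr k c n)
        ≤ Real.exp (-p n) ^ (N - j) * Real.exp (thr k c n) := by
          gcongr
          exact Real.one_sub_le_exp_neg _
      _ = Real.exp (-((N - j : ℕ) * p n) + thr k c n) := by
          rw [← Real.exp_nat_mul, ← Real.exp_add]; congr 2; ring
      _ ≤ _ := by
          rw [Real.exp_le_exp]
          nlinarith [mul_le_mul_of_nonneg_right hsub (h0 n)]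

theorem tendsto_choose_div_pow (j : ℕ) :
    Tendsto (fun N : ℕ => (N.choose j : ℝ) / (N : ℝ) ^ j) atTop (𝓝 (1 / j.factorial)) := by
  have hz : ∀ᶠ N : ℕ in atTop, ((N : ℝ) ^ j / j.factorial) ≠ 0 := by
    filter_upwards [eventually_gt_atTop 0] with N hN
    positivity
  have h := ((Asymptotics.isEquivalent_iff_tendsto_one hz).1 (isEquivalent_choose j)).mul_const
    (1 / (j.factorial : ℝ))
  rw [one_mul] at h
  refine h.congr' ?_
  filter_upwards [eventually_gt_atTop 0] with N hN
  have hN' : (0 : ℝ) < N := by exact_mod_cast hN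
  simp only [Pi.div_apply]
  field_simp

theorem tendsto_choose_sub_atTop (hd : 2 ≤ d) (r : ℕ) :
    Tendsto (fun n : ℕ => (n - r).choose (d - 1)) atTop atTop := by
  refine tendsto_atTop_mono' _ ?_ (tendsto_sub_atTop_nat (r + (d - 1)))
  filter_upwards [eventually_ge_atTop (r + (d - 1))] with n hn
  obtain ⟨a, rfl⟩ := Nat.exists_eq_add_of_le hn
  have h : (a + 1).choose a ≤ (a + (d - 1)).choose a := Nat.choose_le_choose a (by omega)
  rw [Nat.choose_succ_self_right, Nat.choose_symm_add] at h
  rw [show r + (d - 1) + a - (r + (d - 1)) = a by omega,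
    show r + (d - 1) + a - r = a + (d - 1) by omega]
  omega

/-- Degree exactly `j` contributes about e^{-c₀} (ln n)^{j-(k-1)} / j! after multiplication by `n`,
so only `j = k - 1` survives. -/
theorem tendsto_mul_binLt (hd : 2 ≤ d) (hk : 1 ≤ k) (hc : Tendsto c atTop (𝓝 c₀))
    (hp : IsThr d k c p) (h0 : ∀ n, 0 ≤ p n) (r : ℕ) :
    Tendsto (fun n : ℕ => (n : ℝ) * binLt ((n - r).choose (d - 1)) (p n) k) atTop
      (𝓝 (Real.exp (-c₀) / (k - 1).factorial)) := by
  have hterm : ∀ j, Tendsto (fun n : ℕ => (n : ℝ) * (((n - r).choose (d - 1)).choose j * p n ^ j *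
      (1 - p n) ^ ((n - r).choose (d - 1) - j)) * (Real.log n ^ (k - 1) / Real.log n ^ j)) atTop
      (𝓝 (Real.exp (-c₀) / j.factorial)) := by
    intro j
    have h1 := (tendsto_choose_div_pow j).comp (tendsto_choose_sub_atTop hd r)
    have h2 : Tendsto (fun n : ℕ => ((n - r).choose (d - 1) : ℝ) * p n / Real.log n) atTop
        (𝓝 1) := by
      have := ((tendsto_choose_mul_param_sub hc hp r).div_atTop tendsto_log_natCast).add
        (tendsto_thr_div_log k hc)
      rw [zero_add] at this
      exact this.congr fun n => by ring
    have h3 := tendsto_one_sub_pow_mul_exp hd hc hp h0 r j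
    have h4 := hc.neg.rexp
    have h5 := ((h1.mul (h2.pow j)).mul h3).mul h4
    rw [one_pow, mul_one, mul_one, one_div_mul_eq_div] at h5
    refine h5.congr' ?_
    filter_upwards [tendsto_log_natCast.eventually_gt_atTop 0,
      (tendsto_choose_sub_atTop hd r).eventually_gt_atTop 0] with n hn hN
    have hN' : (0 : ℝ) < (n - r).choose (d - 1) := by exact_mod_cast hN
    simp only [Function.comp]
    rw [← exp_neg_thr hk c hn, Real.exp_neg, div_pow, mul_pow]
    have := Real.exp_pos (thr k c n)
    field_simp
  have hall : ∀ j ∈ range k, Tendsto (fun n : ℕ => (n : ℝ) * (((n - r).choose (d - 1)).choose j *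
      p n ^ j * (1 - p n) ^ ((n - r).choose (d - 1) - j))) atTop
      (𝓝 (if j = k - 1 then Real.exp (-c₀) / (k - 1).factorial else 0)) := by
    intro j hj
    have hjk : j + 1 ≤ k := mem_range.1 hj
    split_ifs with hjk'
    · subst hjk'
      refine (hterm (k - 1)).congr' ?_
      filter_upwards [tendsto_log_natCast.eventually_gt_atTop 0] with n hn
      rw [div_self (by positivity), mul_one]
    · have hz : Tendsto (fun n : ℕ => (Real.log n ^ (k - 1 - j))⁻¹) atTop (𝓝 0) :=
        ((tendsto_pow_atTop (by omega)).comp tendsto_log_natCast).inv_tendsto_atTop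
      have h := (hterm j).mul hz
      rw [mul_zero] at h
      refine h.congr' ?_
      filter_upwards [tendsto_log_natCast.eventually_gt_atTop 0] with n hn
      rw [show k - 1 = k - 1 - j + j by omega, pow_add, Nat.add_sub_cancel]
      field_simp
  have hsum := tendsto_finsetSum (range k) hall
  rw [sum_ite_eq' (range k) (k - 1), if_pos (mem_range.2 (by omega))] at hsum
  refine hsum.congr fun n => ?_
  rw [binLt, mul_sum]

end LowDegreeLimit

/-! ### The limiting probability of minimum degree at least `k`. -/

section MinDegree

variable {d k : ℕ} {c : ℕ → ℝ} {c₀ : ℝ} {p : ℕ → ℝ}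

theorem tendsto_lowMoment (hd : 2 ≤ d) (hk : 1 ≤ k) (hc : Tendsto c atTop (𝓝 c₀))
    (hp : IsThr d k c p) (h0 : ∀ n, 0 ≤ p n) (h1 : ∀ n, p n ≤ 1) (r : ℕ) :
    Tendsto (fun n : ℕ => lowMoment d n k (p n) r) atTop
      (𝓝 ((Real.exp (-c₀) / (k - 1).factorial) ^ r / r.factorial)) := by
  have hup : Tendsto (fun n : ℕ => n.choose r * binLt ((n - r).choose (d - 1)) (p n) k ^ r) atTop
      (𝓝 ((Real.exp (-c₀) / (k - 1).factorial) ^ r / r.factorial)) := by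
    have h := (tendsto_choose_div_pow r).mul ((tendsto_mul_binLt hd hk hc hp h0 r).pow r)
    rw [one_div_mul_eq_div] at h
    refine h.congr' ?_
    filter_upwards [eventually_gt_atTop 0] with n hn
    have hn' : (0 : ℝ) < n := by exact_mod_cast hn
    rw [mul_pow]
    field_simp
  -- Edges meeting a fixed `r`-set twice are typically absent, because `n ^ (d - 2) * p n` tends to
  -- 0.
  have hone : Tendsto (fun n : ℕ => (1 - p n) ^ (r ^ 2 * n ^ (d - 2))) atTop (𝓝 1) := by
    have h := (tendsto_pow_mul_param hd hc hp).const_mul ((r : ℝ) ^ 2)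
    have h' := (tendsto_const_nhds (x := (1 : ℝ))).sub h
    rw [mul_zero, sub_zero] at h'
    refine tendsto_of_tendsto_of_tendsto_of_le_of_le h' tendsto_const_nhds (fun n => ?_)
      (fun n => pow_le_one₀ (by linarith [h1 n]) (by linarith [h0 n]))
    have := one_add_mul_le_pow (a := -p n) (by linarith [h1 n]) (r ^ 2 * n ^ (d - 2))
    push_cast at this
    rw [← sub_eq_add_neg] at this
    linarith
  have hlo := hup.mul hone
  rw [mul_one] at hlo
  refine tendsto_of_tendsto_of_tendsto_of_le_of_le hlo hup (fun n => ?_)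
    (fun n => lowMoment_le (by omega) (h0 n) (h1 n) k r)
  have := le_lowMoment (n := n) hd (h0 n) (h1 n) k r
  rwa [← mul_assoc] at this

theorem tendsto_binProb_minDeg (hd : 2 ≤ d) (hk : 1 ≤ k) (hc : Tendsto c atTop (𝓝 c₀))
    (hp : IsThr d k c p) (h0 : ∀ n, 0 ≤ p n) (h1 : ∀ n, p n ≤ 1) :
    Tendsto (fun n : ℕ => binProb (edges d n) (p n) (fun E => ∀ v, k ≤ deg E v)) atTop
      (𝓝 (Real.exp (-(Real.exp (-c₀) / (k - 1).factorial)))) :=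
  tendsto_exp_of_alternating_bounds (tendsto_lowMoment hd hk hc hp h0 h1)
    (fun R n => binProb_minDeg_le (h0 n) (h1 n) k R)
    (fun R n => le_binProb_minDeg (h0 n) (h1 n) k R)

end MinDegree

/-! ### Separated sets are negligible when the minimum degree is at least `k`. -/

section Separation

/-- The bound for the expected number of separated vertex sets with `u` elements, for small `u`. -/
theorem separated_small {n u s k : ℕ} (hn : 0 < n) (hks : k = s + 1) {L B K f q : ℝ} (hL : 0 ≤ L)
    (hf : 0 ≤ f) (hq0 : 0 ≤ q) (hq : q ≤ Real.exp (-(u * (L - 1)))) (hB : n * Real.exp (-L) ≤ K)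
    (hBdef : B = f * (L / n)) :
    (n : ℝ) ^ s * (n.choose u * (q * ((u + s) * B) ^ k)) ≤
      (f * L) ^ k / n * ((u + s) ^ k * ((Real.exp 1 * K) ^ u / u.factorial)) := by
  have hn' : (0 : ℝ) < n := by exact_mod_cast hn
  have hB0 : 0 ≤ B := by rw [hBdef]; positivity
  -- The choices of `U` and the missing edges balance: `n * exp (-L)` is bounded, so each vertex of
  -- `U` costs a constant, later tamed by `u !`.
  have hE : (n : ℝ) ^ u * Real.exp (-(u * (L - 1))) ≤ (Real.exp 1 * K) ^ u := by
    have : Real.exp (-(u * (L - 1))) = (Real.exp 1 * Real.exp (-L)) ^ u := by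
      rw [← Real.exp_add, ← Real.exp_nat_mul]; congr 1; ring
    rw [this, ← mul_pow]
    refine pow_le_pow_left₀ (by positivity) ?_ u
    calc n * (Real.exp 1 * Real.exp (-L)) = Real.exp 1 * (n * Real.exp (-L)) := by ring
      _ ≤ _ := by gcongr
  calc (n : ℝ) ^ s * (n.choose u * (q * ((u + s) * B) ^ k))
      ≤ (n : ℝ) ^ s * ((n : ℝ) ^ u / u.factorial *
          (Real.exp (-(u * (L - 1))) * ((u + s) * B) ^ k)) := by
        gcongr
        exact Nat.choose_le_pow_div u n
    _ = (n : ℝ) ^ s * ((u + s) * B) ^ k / u.factorial *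
          ((n : ℝ) ^ u * Real.exp (-(u * (L - 1)))) := by ring
    _ ≤ (n : ℝ) ^ s * ((u + s) * B) ^ k / u.factorial * (Real.exp 1 * K) ^ u := by gcongr
    _ = _ := by
        -- The `n ^ s` choices of the separator against `n ^ (s + 1)` from `B ^ k` leave the
        -- decisive `1 / n`.
        rw [hBdef, hks, mul_pow, mul_pow, div_pow, mul_pow, pow_succ (n : ℝ) s]
        field_simp
        ring

theorem choose_le_exp {n u : ℕ} (hu : 0 < u) {y : ℝ} (hy : n / u ≤ Real.exp y) :
    (n.choose u : ℝ) ≤ Real.exp (u * (1 + y)) := by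
  have hu' : (0 : ℝ) < u := by exact_mod_cast hu
  have h1 : (u : ℝ) ^ u / u.factorial ≤ Real.exp u :=
    Real.pow_div_factorial_le_exp u hu'.le u
  calc (n.choose u : ℝ) ≤ (n : ℝ) ^ u / u.factorial := Nat.choose_le_pow_div u n
    _ = (n / u : ℝ) ^ u * ((u : ℝ) ^ u / u.factorial) := by rw [div_pow]; field_simp
    _ ≤ Real.exp y ^ u * Real.exp u := by gcongr
    _ = _ := by rw [← Real.exp_nat_mul, ← Real.exp_add]; congr 1; ring

/-- The bound for the expected number of separated vertex sets with `u` elements, for large `u`. -/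
theorem separated_large {n u s k : ℕ} (hu : 0 < u) (hus : u + s ≤ n) (hks : k = s + 1)
    {L B f q β : ℝ} (hL : 3 / 4 * Real.log n ≤ L) (hf : 0 ≤ f) (hq0 : 0 ≤ q)
    (hβ : 0 < β) (hq : q ≤ Real.exp (-(u * (β * L)))) (hBdef : B = f * (L / n))
    (hbig : 8 ≤ β * Real.log n) (hun : (n : ℝ) ^ (1 - β / 2) ≤ u) (huM : 8 * (s + 2) ≤ β * u) :
    (n : ℝ) ^ s * (n.choose u * (q * ((u + s) * B) ^ k)) ≤ (f * L) ^ k / n * (1 / n) := by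
  have hn0 : 0 < n := by omega
  have hn' : (0 : ℝ) < n := by exact_mod_cast hn0
  have hu' : (0 : ℝ) < u := by exact_mod_cast hu
  have hlog : 0 < Real.log n := by
    by_contra! h
    nlinarith
  have hL0 : 0 ≤ L := by linarith
  have hfac : ((u + s) * B) ^ k ≤ (f * L) ^ k := by
    have hle : ((u : ℝ) + s) ≤ n := by exact_mod_cast hus
    have : 0 ≤ ((u : ℝ) + s) * B := by rw [hBdef]; positivity
    refine pow_le_pow_left₀ this ?_ k
    calc ((u : ℝ) + s) * B ≤ n * B := by
          refine mul_le_mul_of_nonneg_right hle ?_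
          rw [hBdef]; positivity
      _ = f * L := by rw [hBdef]; field_simp
  -- Since `u ≥ n ^ (1 - β / 2)`, the ratio `n / u` is at most `n ^ (β / 2)`.
  have hch : (n.choose u : ℝ) ≤ Real.exp (u * (1 + β / 2 * Real.log n)) := by
    refine choose_le_exp hu ?_
    rw [div_le_iff₀ hu']
    calc (n : ℝ) = Real.exp (β / 2 * Real.log n) * (n : ℝ) ^ (1 - β / 2) := by
          rw [Real.rpow_def_of_pos hn', ← Real.exp_add]
          nth_rewrite 1 [← Real.exp_log hn']
          congr 1; ring
      _ ≤ _ := by gcongr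
  have hmain : (n : ℝ) ^ s * (Real.exp (u * (1 + β / 2 * Real.log n)) *
      Real.exp (-(u * (β * L)))) ≤ 1 / n * (1 / n) := by
    have e1 : (n : ℝ) ^ s = Real.exp (s * Real.log n) := by
      rw [Real.exp_nat_mul, Real.exp_log hn']
    have e2 : (1 : ℝ) / n = Real.exp (-Real.log n) := by
      rw [Real.exp_neg, Real.exp_log hn', one_div]
    rw [e1, e2, ← Real.exp_add, ← Real.exp_add, ← Real.exp_add, Real.exp_le_exp]
    -- The exponent is at most s ln n + u - (β/4) u ln n. By `a2` the term u uses half of the (β/4)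
    -- u ln n, and by `a3` the rest is at least (s + 2) ln n, leaving -2 ln n.
    have a1 : (u : ℝ) * (β * (3 / 4 * Real.log n)) ≤ u * (β * L) := by gcongr
    have a2 : (u : ℝ) * 8 ≤ u * (β * Real.log n) := by gcongr
    have a3 : 8 * ((s : ℝ) + 2) * Real.log n ≤ β * u * Real.log n := by gcongr
    nlinarith
  calc (n : ℝ) ^ s * (n.choose u * (q * ((u + s) * B) ^ k))
      ≤ (n : ℝ) ^ s * (Real.exp (u * (1 + β / 2 * Real.log n)) *
          (Real.exp (-(u * (β * L))) * (f * L) ^ k)) := by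
        have : 0 ≤ ((u + s) * B) ^ k := by
          have : 0 ≤ B := by rw [hBdef]; positivity
          positivity
        gcongr
    _ = (f * L) ^ k * ((n : ℝ) ^ s * (Real.exp (u * (1 + β / 2 * Real.log n)) *
          Real.exp (-(u * (β * L))))) := by ring
    _ ≤ (f * L) ^ k * (1 / n * (1 / n)) := by gcongr
    _ = _ := by ring

/-- The polynomial factor is at most k! e^{u+s}, which the exponential series absorbs; the bound is
uniform in `T`. -/
theorem sum_pow_mul_pow_div_factorial_le (T : Finset ℕ) (s k : ℕ) {x : ℝ} (hx : 0 ≤ x) :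
    ∑ u ∈ T, ((u : ℝ) + s) ^ k * (x ^ u / u.factorial) ≤
      k.factorial * Real.exp s * Real.exp (Real.exp 1 * x) := by
  have hs : Summable fun u : ℕ => (Real.exp 1 * x) ^ u / u.factorial :=
    Real.summable_pow_div_factorial _
  have he : ∑' u : ℕ, (Real.exp 1 * x) ^ u / u.factorial = Real.exp (Real.exp 1 * x) := by
    rw [Real.exp_eq_exp_ℝ, NormedSpace.exp_eq_tsum_div]
  calc ∑ u ∈ T, ((u : ℝ) + s) ^ k * (x ^ u / u.factorial)
      ≤ ∑ u ∈ T, k.factorial * Real.exp s * ((Real.exp 1 * x) ^ u / u.factorial) := by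
        refine sum_le_sum fun u _ => ?_
        have h := Real.pow_div_factorial_le_exp (x := (u : ℝ) + s) (by positivity) k
        rw [div_le_iff₀ (by positivity)] at h
        have e : Real.exp ((u : ℝ) + s) = Real.exp 1 ^ u * Real.exp s := by
          rw [Real.exp_add, ← Real.exp_nat_mul, mul_one]
        calc ((u : ℝ) + s) ^ k * (x ^ u / u.factorial)
            ≤ (Real.exp ((u : ℝ) + s) * k.factorial) * (x ^ u / u.factorial) := by gcongr
          _ = _ := by rw [e, mul_pow]; ring
    _ = k.factorial * Real.exp s * ∑ u ∈ T, (Real.exp 1 * x) ^ u / u.factorial := by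
        rw [mul_sum]
    _ ≤ _ := by
        gcongr
        rw [← he]
        exact hs.sum_le_tsum T fun u _ => by positivity

variable {d k : ℕ} {c : ℕ → ℝ} {c₀ : ℝ} {p : ℕ → ℝ}

theorem tendsto_binProb_minDeg_not_kConn (hd : 2 ≤ d) (hk : 1 ≤ k) (hc : Tendsto c atTop (𝓝 c₀))
    (hp : IsThr d k c p) (h0 : ∀ n, 0 ≤ p n) (h1 : ∀ n, p n ≤ 1) :
    Tendsto (fun n : ℕ => binProb (edges d n) (p n) (fun E => (∀ v, k ≤ deg E v) ∧ ¬ KConn k E))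
      atTop (𝓝 0) := by
  obtain ⟨s, rfl⟩ : ∃ s, k = s + 1 := ⟨k - 1, by omega⟩
  obtain ⟨D, rfl⟩ : ∃ D, d = D + 2 := ⟨d - 2, by omega⟩
  set f : ℝ := ((D + 1).factorial : ℝ) with hf
  -- For `u ≤ n / 2` and large `n`, at least a third of the vertices lie outside `U ∪ S` even after
  -- removing `D + 1` more, so the expected pinned degree is at least `β * L`.
  set β : ℝ := (1 / 3) ^ (D + 1) with hβ
  have hβ0 : 0 < β := by positivity
  have hβ1 : β ≤ 1 := pow_le_one₀ (by norm_num) (by norm_num)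
  set K : ℝ := Real.exp (-(c₀ - 1)) with hK
  set C : ℝ := (s + 1).factorial * Real.exp s * Real.exp (Real.exp 1 * (Real.exp 1 * K)) + 1 with hC
  have hlim : Tendsto (fun n : ℕ => (f ^ (s + 1) * C) * (thr (s + 1) c n ^ (s + 1) / n)) atTop
      (𝓝 0) := by
    have := (tendsto_thr_pow_div (s + 1) hc (s + 1)).const_mul (f ^ (s + 1) * C)
    rwa [mul_zero] at this
  -- This bounds the loss in the pinned degree for `u < n ^ (1 - β / 2)`; once below 1, it gives the
  -- `L - 1` of the small case.
  have hsmall : Tendsto (fun n : ℕ => ((D + 1 : ℕ) : ℝ) * (thr (s + 1) c n / (n : ℝ) ^ (β / 2) +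
      (s + (D + 1 : ℕ)) * (thr (s + 1) c n / n))) atTop (𝓝 0) := by
    have := ((tendsto_thr_div_rpow (s + 1) hc (half_pos hβ0)).add
      ((tendsto_thr_div (s + 1) hc).const_mul ((s : ℝ) + (D + 1 : ℕ)))).const_mul
        ((D + 1 : ℕ) : ℝ)
    simpa using this
  have hpow : Tendsto (fun n : ℕ => (n : ℝ) ^ (1 - β / 2)) atTop atTop :=
    (tendsto_rpow_atTop (by linarith)).comp tendsto_natCast_atTop_atTop
  refine squeeze_zero' (Eventually.of_forall fun n => binProb_nonneg (h0 n) (h1 n) _) ?_ hlim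
  filter_upwards [hp, eventually_ge_atTop (6 * (s + D + 2)),
    hsmall.eventually (gt_mem_nhds one_pos),
    hpow.eventually_ge_atTop (8 * (s + 2) / β),
    tendsto_log_natCast.eventually_ge_atTop (8 / β),
    tendsto_log_natCast.eventually_ge_atTop 1,
    (tendsto_thr_div_log (s + 1) hc).eventually (lt_mem_nhds (show (3 / 4 : ℝ) < 1 by norm_num)),
    hc.eventually (lt_mem_nhds (show c₀ - 1 < c₀ by linarith))] with
    n hpn hn hsm hpw hlog8 hlog1 hthr hcn
  set L := thr (s + 1) c n with hLdef
  have hn0 : 0 < n := by omega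
  have hn' : (0 : ℝ) < n := by exact_mod_cast hn0
  have hlog0 : 0 < Real.log n := by linarith
  have hL : 3 / 4 * Real.log n ≤ L := by
    rw [lt_div_iff₀ hlog0] at hthr
    exact hthr.le
  have hL0 : 0 ≤ L := by linarith
  have hKb : n * Real.exp (-L) ≤ K := by
    have h := exp_neg_thr (k := s + 1) (by omega) c hlog0
    have h2 : (1 : ℝ) ≤ Real.log n ^ (s + 1 - 1) := one_le_pow₀ hlog1
    calc n * Real.exp (-L) ≤ n * Real.exp (-L) * Real.log n ^ (s + 1 - 1) :=
          le_mul_of_one_le_right (by positivity) h2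
      _ = Real.exp (-c n) := h
      _ ≤ K := Real.exp_le_exp.2 (by linarith)
  have hB : (n : ℝ) ^ (D + 2 - 2) * p n = f * (L / n) := by
    rw [hpn, show D + 2 - 1 = D + 1 from rfl, show D + 2 - 2 = D from rfl, pow_succ]
    field_simp
    rw [hf, mul_comm]
  refine (binProb_minDeg_not_kConn_le hd (by omega : s + 1 < n) (h0 n) (h1 n)).trans ?_
  -- The bounds for small and large `u` are added, which avoids splitting the sum; the extra `1 / n`
  -- sums to at most 1.
  have hterm : ∀ u ∈ Icc 1 (n / 2), (n : ℝ) ^ (s + 1 - 1) * (n.choose u *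
        ((1 - p n) ^ (u * (n - (u + (s + 1 - 1))).choose (D + 2 - 1)) *
          ((u + (s + 1 - 1 : ℕ)) * n ^ (D + 2 - 2) * p n) ^ (s + 1))) ≤
      (f * L) ^ (s + 1) / n *
        ((u + s) ^ (s + 1) * ((Real.exp 1 * K) ^ u / u.factorial) + 1 / n) := by
    intro u hu
    obtain ⟨hu1, hu2⟩ := mem_Icc.1 hu
    have hu' : (0 : ℝ) < u := by exact_mod_cast hu1
    rw [show s + 1 - 1 = s from rfl, show D + 2 - 1 = D + 1 from rfl]
    rw [mul_assoc ((u : ℝ) + s), hB]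
    set N := (n - (u + s)).choose (D + 1) with hN
    have hq0 : 0 ≤ (1 - p n) ^ (u * N) := pow_nonneg (by linarith [h1 n]) _
    have hq : (1 - p n) ^ (u * N) ≤ Real.exp (-(u * (N * p n))) := by
      calc (1 - p n) ^ (u * N) ≤ Real.exp (-p n) ^ (u * N) :=
            pow_le_pow_left₀ (by linarith [h1 n]) (Real.one_sub_le_exp_neg _) _
        _ = _ := by rw [← Real.exp_nat_mul]; push_cast; congr 1; ring
    have hxD : u + s + (D + 1) ≤ n := by omega
    have hle1 := le_choose_mul (D := D + 1) hn0 hxD hL0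
    have hle2 := le_choose_mul' (D := D + 1) hn0 hxD hL0
    rw [show ((D + 1).factorial : ℝ) * (L / (n : ℝ) ^ (D + 1)) = p n from hpn.symm, ← hN]
      at hle1 hle2
    have hnn1 : 0 ≤ (f * L) ^ (s + 1) / n * (1 / n) := by positivity
    have hnn2 : 0 ≤ (f * L) ^ (s + 1) / n *
        (((u : ℝ) + s) ^ (s + 1) * ((Real.exp 1 * K) ^ u / u.factorial)) := by positivity
    rw [mul_add]
    rcases le_or_gt ((n : ℝ) ^ (1 - β / 2)) u with hcase | hcase
    · have h2 : N * p n ≥ β * L := by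
        refine le_trans ?_ hle1
        refine mul_le_mul_of_nonneg_right (pow_le_pow_left₀ (by norm_num) ?_ _) hL0
        have : ((u + s : ℕ) + (D + 1 : ℕ) : ℝ) / n ≤ 2 / 3 := by
          rw [div_le_iff₀ hn']
          have h3 : 3 * (u + s + (D + 1)) ≤ 2 * n := by omega
          have h4 : (3 : ℝ) * ((u + s : ℕ) + (D + 1 : ℕ)) ≤ 2 * n := by exact_mod_cast h3
          linarith
        linarith
      refine le_trans (separated_large hu1 (by omega) rfl hL (by positivity) hq0 hβ0
        (hq.trans (Real.exp_le_exp.2 ?_)) rfl ?_ hcase ?_) (le_add_of_nonneg_left hnn2)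
      · have := mul_le_mul_of_nonneg_left h2 hu'.le
        linarith
      · rw [div_le_iff₀ hβ0] at hlog8; linarith
      · have := hpw.trans hcase
        rw [div_le_iff₀ hβ0] at this; linarith
    · have h2 : L - 1 ≤ N * p n := by
        refine le_trans ?_ hle2
        have e : (n : ℝ) ^ (1 - β / 2) / n = 1 / (n : ℝ) ^ (β / 2) := by
          rw [Real.rpow_sub hn', Real.rpow_one]; field_simp
        have h3 : ((D + 1 : ℕ) : ℝ) * (((u + s : ℕ) + (D + 1 : ℕ) : ℝ) / n) * L ≤
            ((D + 1 : ℕ) : ℝ) * (L / (n : ℝ) ^ (β / 2) + (s + (D + 1 : ℕ)) * (L / n)) := by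
          rw [mul_assoc]
          refine mul_le_mul_of_nonneg_left ?_ (Nat.cast_nonneg _)
          calc ((u + s : ℕ) + (D + 1 : ℕ) : ℝ) / n * L
              = u / n * L + (s + (D + 1 : ℕ)) * (L / n) := by push_cast; ring
            _ ≤ (n : ℝ) ^ (1 - β / 2) / n * L + (s + (D + 1 : ℕ)) * (L / n) := by gcongr
            _ = _ := by rw [e]; ring
        linarith
      refine le_trans (separated_small hn0 rfl hL0 (by positivity) hq0
        (hq.trans (Real.exp_le_exp.2 ?_)) hKb rfl) (le_add_of_nonneg_right hnn1)
      have := mul_le_mul_of_nonneg_left h2 hu'.le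
      linarith
  refine (sum_le_sum hterm).trans ?_
  rw [← mul_sum, sum_add_distrib]
  have hs1 := sum_pow_mul_pow_div_factorial_le (Icc 1 (n / 2)) s (s + 1)
    (x := Real.exp 1 * K) (by positivity)
  have hs2 : ∑ _u ∈ Icc 1 (n / 2), (1 : ℝ) / n ≤ 1 := by
    rw [sum_const, Nat.card_Icc, nsmul_eq_mul, mul_one_div, div_le_one hn']
    exact_mod_cast (by omega : n / 2 + 1 - 1 ≤ n)
  calc _ ≤ (f * L) ^ (s + 1) / n * C := by
        refine mul_le_mul_of_nonneg_left ?_ (by positivity)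
        rw [hC]
        linarith
    _ = _ := by rw [mul_pow]; ring

theorem tendsto_binProb_kConn (hd : 2 ≤ d) (hk : 1 ≤ k) (hc : Tendsto c atTop (𝓝 c₀))
    (hp : IsThr d k c p) (h0 : ∀ n, 0 ≤ p n) (h1 : ∀ n, p n ≤ 1) :
    Tendsto (fun n : ℕ => binProb (edges d n) (p n) (KConn k)) atTop
      (𝓝 (Real.exp (-(Real.exp (-c₀) / (k - 1).factorial)))) := by
  have hmin := tendsto_binProb_minDeg hd hk hc hp h0 h1
  have hlo := hmin.sub (tendsto_binProb_minDeg_not_kConn hd hk hc hp h0 h1)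
  rw [sub_zero] at hlo
  refine tendsto_of_tendsto_of_tendsto_of_le_of_le hlo hmin (fun n => ?_) (fun n => ?_)
  · refine sub_le_iff_le_add.2 (binProb_le_add (h0 n) (h1 n) fun E _ h => ?_)
    by_cases hK : KConn k E
    · exact Or.inl hK
    · exact Or.inr ⟨h, hK⟩
  · exact binProb_mono (h0 n) (h1 n) fun E hE h => le_deg_of_kConn hd hE h

end Separation

/-! ### Neighbouring thresholds and transfer to the uniform model. -/

section Comparison

variable {d k : ℕ} {c : ℕ → ℝ} {c₀ : ℝ} {p : ℕ → ℝ}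

/-- Supplies comparison probabilities for other constants and other `k`. The clamping to [0, 1] is
inactive for large `n`, where the formula is nonnegative and tends to 0. -/
theorem exists_isThr (hd : 2 ≤ d) (k : ℕ) (hc : Tendsto c atTop (𝓝 c₀)) :
    ∃ p : ℕ → ℝ, IsThr d k c p ∧ (∀ n, 0 ≤ p n) ∧ ∀ n, p n ≤ 1 := by
  refine ⟨fun n => max 0 (min 1 (((d - 1).factorial : ℝ) * (thr k c n / (n : ℝ) ^ (d - 1)))), ?_,
    fun n => le_max_left _ _, fun n => max_le zero_le_one (min_le_left _ _)⟩
  have h := (tendsto_thr_div k hc).const_mul ((d - 1).factorial : ℝ)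
  rw [mul_zero] at h
  filter_upwards [h.eventually (gt_mem_nhds one_pos), eventually_gt_atTop 0,
    (tendsto_thr_atTop k hc).eventually_ge_atTop 0] with n hlt hn hL
  have hn1 : (1 : ℝ) ≤ n := by exact_mod_cast hn
  have hn' : (n : ℝ) ≤ (n : ℝ) ^ (d - 1) := le_self_pow₀ hn1 (by omega)
  have hle : ((d - 1).factorial : ℝ) * (thr k c n / (n : ℝ) ^ (d - 1)) ≤
      ((d - 1).factorial : ℝ) * (thr k c n / n) := by gcongr
  rw [min_eq_right (hle.trans hlt.le), max_eq_right (by positivity)]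

theorem binProb_mono_param {ι : Type*} {G : Finset ι} {p q : ℝ} (h0 : 0 ≤ p) (hpq : p ≤ q)
    (h1 : q ≤ 1) {A : Finset ι → Prop} (hA : Monotone A) : binProb G p A ≤ binProb G q A := by
  refine binExp_mono_param h0 hpq h1 fun E F hEF => ?_
  have := hA hEF
  split_ifs with h2 h3
  · exact le_rfl
  · exact absurd (this h2) h3
  · exact zero_le_one
  · exact le_rfl

theorem IsThr.eventually_le {k' : ℕ} {c' p' : ℕ → ℝ} (hp : IsThr d k c p) (hp' : IsThr d k' c' p')
    (h : ∀ᶠ n in atTop, thr k c n ≤ thr k' c' n) : ∀ᶠ n in atTop, p n ≤ p' n := by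
  filter_upwards [hp, hp', h] with n h1 h2 h3
  rw [h1, h2]
  gcongr

theorem tendsto_log_log_add (hc : Tendsto c atTop (𝓝 c₀)) :
    Tendsto (fun n : ℕ => Real.log (Real.log n) + c n) atTop atTop :=
  (Real.tendsto_log_atTop.comp tendsto_log_natCast).atTop_add hc

theorem tendsto_log_log_sub (hc : Tendsto c atTop (𝓝 c₀)) :
    Tendsto (fun n : ℕ => Real.log (Real.log n) - c n) atTop atTop := by
  simpa only [sub_eq_add_neg] using tendsto_log_log_add hc.neg

/-- By the `log log` gap, `p` eventually exceeds the threshold probability for `k - 1` with any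
constant `C`, and the limit for that constant tends to 1 as `C` grows. For `k = 1` the property is
trivial. -/
theorem tendsto_binProb_kConn_pred (hd : 2 ≤ d) (hk : 1 ≤ k) (hc : Tendsto c atTop (𝓝 c₀))
    (hp : IsThr d k c p) (h0 : ∀ n, 0 ≤ p n) (h1 : ∀ n, p n ≤ 1) :
    Tendsto (fun n : ℕ => binProb (edges d n) (p n) (KConn (k - 1))) atTop (𝓝 1) := by
  rcases hk.eq_or_lt with rfl | hk
  · refine tendsto_const_nhds.congr' ?_
    filter_upwards [eventually_gt_atTop 0] with n hn
    rw [← binProb_true (edges d n) (p n)]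
    exact binProb_congr fun E _ => ⟨fun _ => kConn_zero hn E, fun _ => trivial⟩
  · refine tendsto_order.2 ⟨fun a ha => ?_, fun a ha => Eventually.of_forall fun n =>
      (binProb_le_one (h0 n) (h1 n) _).trans_lt ha⟩
    have hlim : Tendsto (fun C : ℝ => Real.exp (-(Real.exp (-C) / (k - 1 - 1).factorial))) atTop
        (𝓝 1) := by
      have := ((Real.tendsto_exp_neg_atTop_nhds_zero.div_const
        ((k - 1 - 1).factorial : ℝ)).neg).rexp
      simpa using this
    obtain ⟨C, hC⟩ := (hlim.eventually (lt_mem_nhds ha)).exists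
    obtain ⟨q, hq, hq0, hq1⟩ := exists_isThr hd (k - 1) (tendsto_const_nhds (x := C))
    have hle : ∀ᶠ n in atTop, q n ≤ p n := by
      refine hq.eventually_le hp ?_
      filter_upwards [(tendsto_log_log_add hc).eventually_ge_atTop C] with n hn
      rw [thr, thr, Nat.cast_sub hk.le, Nat.cast_one]
      linarith
    filter_upwards [hle, (tendsto_binProb_kConn hd (by omega) tendsto_const_nhds hq hq0
      hq1).eventually (lt_mem_nhds hC)] with n hn hlt
    exact hlt.trans_le (binProb_mono_param (hq0 n) hn (h1 n) (kConn_mono _))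

/-- Dually, `p` eventually lies below the threshold probability for `k + 1` with constant `-C`,
whose limit tends to 0 as `C` grows. -/
theorem tendsto_binProb_kConn_succ (hd : 2 ≤ d) (hc : Tendsto c atTop (𝓝 c₀))
    (hp : IsThr d k c p) (h0 : ∀ n, 0 ≤ p n) (h1 : ∀ n, p n ≤ 1) :
    Tendsto (fun n : ℕ => binProb (edges d n) (p n) (KConn (k + 1))) atTop (𝓝 0) := by
  refine tendsto_order.2 ⟨fun a ha => Eventually.of_forall fun n =>
      ha.trans_le (binProb_nonneg (h0 n) (h1 n) _), fun a ha => ?_⟩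
  have hlim : Tendsto (fun C : ℝ => Real.exp (-(Real.exp (-(-C)) / (k + 1 - 1).factorial))) atTop
      (𝓝 0) := by
    simp only [neg_neg]
    exact Real.tendsto_exp_neg_atTop_nhds_zero.comp
      (Real.tendsto_exp_atTop.atTop_div_const (by positivity))
  obtain ⟨C, hC⟩ := (hlim.eventually (gt_mem_nhds ha)).exists
  obtain ⟨q, hq, hq0, hq1⟩ := exists_isThr hd (k + 1) (tendsto_const_nhds (x := -C))
  have hle : ∀ᶠ n in atTop, p n ≤ q n := by
    refine hp.eventually_le hq ?_
    filter_upwards [(tendsto_log_log_sub hc).eventually_ge_atTop C] with n hn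
    rw [thr, thr, Nat.cast_add, Nat.cast_one]
    linarith
  filter_upwards [hle, (tendsto_binProb_kConn hd (by omega) tendsto_const_nhds hq hq0
    hq1).eventually (gt_mem_nhds hC)] with n hn hlt
  exact (binProb_mono_param (h0 n) hn (hq1 n) (kConn_mono _)).trans_lt hlt

/-- Expected edge count over `n / d` is the expected degree, by `n * (n - 1).choose (d - 1) = d *
n.choose d`. -/
theorem tendsto_mean_sub_thr (hd : 2 ≤ d) (hc : Tendsto c atTop (𝓝 c₀)) (hp : IsThr d k c p) :
    Tendsto (fun n : ℕ => (n.choose d : ℝ) * p n / (n / d) - thr k c n) atTop (𝓝 0) := by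
  refine (tendsto_choose_mul_param_sub hc hp 1).congr' ?_
  filter_upwards [eventually_gt_atTop 0] with n hn
  have hn' : (0 : ℝ) < n := by exact_mod_cast hn
  have hd' : (0 : ℝ) < d := by exact_mod_cast (by omega : 0 < d)
  have h := Nat.add_one_mul_choose_eq (n - 1) (d - 1)
  rw [show n - 1 + 1 = n by omega, show d - 1 + 1 = d by omega] at h
  have h' : (n : ℝ) * (n - 1).choose (d - 1) = n.choose d * d := by exact_mod_cast h
  congr 1
  rw [eq_div_iff (by positivity)]
  calc _ = ((n : ℝ) * (n - 1).choose (d - 1)) * p n / d := by ring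
    _ = _ := by rw [h']; field_simp

/-- The Chebyshev error: a variance of order `n * thr` against a squared deviation of order `n ^ 2`.
-/
theorem tendsto_variance_bound (hd : 2 ≤ d) (hc : Tendsto c atTop (𝓝 c₀)) (hp : IsThr d k c p)
    {ε : ℝ} (hε : 0 < ε) :
    Tendsto (fun n : ℕ => (n.choose d : ℝ) * p n / (n / d * (ε / 4)) ^ 2) atTop (𝓝 0) := by
  have h1 := (tendsto_mean_sub_thr hd hc hp).div_atTop
    (tendsto_natCast_atTop_atTop (R := ℝ))
  have h2 := ((h1.add (tendsto_thr_div k hc)).const_mul (16 * d / ε ^ 2))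
  simp only [add_zero, mul_zero] at h2
  refine h2.congr' ?_
  filter_upwards [eventually_gt_atTop 0] with n hn
  have hn' : (0 : ℝ) < n := by exact_mod_cast hn
  have hd' : (0 : ℝ) < d := by exact_mod_cast (by omega : 0 < d)
  rw [← add_div, sub_add_cancel]
  field_simp
  ring

/-- The uniform model is sandwiched between binomial models. -/
theorem tendsto_unifProb (hd : 2 ≤ d) (hc : Tendsto c atTop (𝓝 c₀)) {m : ℕ → ℕ}
    (hm : ∀ᶠ n : ℕ in atTop, |(m n : ℝ) - (n : ℝ) / d * thr k c n| < 1)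
    {A : ∀ n, Finset (Finset (Fin n)) → Prop} (hA : ∀ n, Monotone (A n)) {g : ℝ → ℝ}
    (hg : ContinuousAt g 0)
    (hlim : ∀ ε (p : ℕ → ℝ), IsThr d k (fun n => c n + ε) p → (∀ n, 0 ≤ p n) → (∀ n, p n ≤ 1) →
      Tendsto (fun n => binProb (edges d n) (p n) (A n)) atTop (𝓝 (g ε))) :
    Tendsto (fun n => unifProb (edges d n) (m n) (A n)) atTop (𝓝 (g 0)) := by
  have hd' : (0 : ℝ) < d := by exact_mod_cast (by omega : 0 < d)
  have hthr : ∀ ε n, thr k (fun n => c n + ε) n = thr k c n + ε := fun ε n => by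
    simp only [thr]; ring
  have hcε : ∀ ε, Tendsto (fun n => c n + ε) atTop (𝓝 (c₀ + ε)) := fun ε => hc.add_const ε
  -- In units of `n / d`, the shift separates the mean from `m` by `ε`. Of this `ε / 2` goes to the
  -- error in the mean and `ε / 4` to the rounding of `m`, leaving `ε / 4` for the deviation.
  have hlow : ∀ ε (p : ℕ → ℝ), 0 < ε → IsThr d k (fun n => c n + -ε) p →
      ∀ᶠ n in atTop, (n.choose d : ℝ) * p n + n / d * (ε / 4) ≤ m n := by
    intro ε p hε hp
    filter_upwards [hm, (tendsto_mean_sub_thr hd (hcε (-ε)) hp).eventually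
        (gt_mem_nhds (show 0 < ε / 2 by positivity)), eventually_gt_atTop 0,
      tendsto_natCast_atTop_atTop.eventually_ge_atTop (4 * d / ε)] with n hmn hmean hn hbig
    have hn' : (0 : ℝ) < n := by exact_mod_cast hn
    have hnd : (0 : ℝ) < n / d := by positivity
    rw [hthr, sub_lt_iff_lt_add, div_lt_iff₀ hnd] at hmean
    have h1 : 1 ≤ (n : ℝ) / d * (ε / 4) := by
      rw [div_le_iff₀ hε] at hbig
      rw [div_mul_div_comm, one_le_div (by positivity)]
      linarith
    have h2 := (abs_lt.1 hmn).1
    nlinarith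
  have hhigh : ∀ ε (p : ℕ → ℝ), 0 < ε → IsThr d k (fun n => c n + ε) p →
      ∀ᶠ n in atTop, m n + n / d * (ε / 4) ≤ (n.choose d : ℝ) * p n := by
    intro ε p hε hp
    filter_upwards [hm, (tendsto_mean_sub_thr hd (hcε ε) hp).eventually
        (lt_mem_nhds (show -(ε / 2) < 0 by linarith)), eventually_gt_atTop 0,
      tendsto_natCast_atTop_atTop.eventually_ge_atTop (4 * d / ε)] with n hmn hmean hn hbig
    have hn' : (0 : ℝ) < n := by exact_mod_cast hn
    have hnd : (0 : ℝ) < n / d := by positivity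
    rw [hthr, lt_sub_iff_add_lt, lt_div_iff₀ hnd] at hmean
    have h1 : 1 ≤ (n : ℝ) / d * (ε / 4) := by
      rw [div_le_iff₀ hε] at hbig
      rw [div_mul_div_comm, one_le_div (by positivity)]
      linarith
    have h2 := (abs_lt.1 hmn).2
    nlinarith
  have hmG : ∀ᶠ n in atTop, m n ≤ n.choose d := by
    obtain ⟨p, hp, h0, h1⟩ := exists_isThr hd k (hcε 1)
    filter_upwards [hhigh 1 p one_pos hp] with n hn
    have h2 : (0 : ℝ) ≤ n / d * (1 / 4) := by positivity
    have h3 : (n.choose d : ℝ) * p n ≤ n.choose d :=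
      mul_le_of_le_one_right (Nat.cast_nonneg _) (h1 n)
    exact_mod_cast (by linarith : (m n : ℝ) ≤ n.choose d)
  -- Continuity of `g` at 0 provides a positive `ε` for which the shifted limit is still on the
  -- right side of `a`.
  refine tendsto_order.2 ⟨fun a ha => ?_, fun a ha => ?_⟩
  · have hg' : Tendsto (fun ε : ℝ => g (-ε)) (𝓝[>] 0) (𝓝 (g 0)) := by
      refine Tendsto.mono_left ?_ nhdsWithin_le_nhds
      have hneg : Tendsto (fun ε : ℝ => -ε) (𝓝 0) (𝓝 0) := by
        simpa using (tendsto_id (α := ℝ) (x := 𝓝 0)).neg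
      exact Tendsto.comp hg hneg
    obtain ⟨ε, hgε, hε⟩ := ((hg'.eventually (lt_mem_nhds ha)).and self_mem_nhdsWithin).exists
    have hε : 0 < ε := hε
    obtain ⟨p, hp, h0, h1⟩ := exists_isThr hd k (hcε (-ε))
    have hl := (hlim (-ε) p hp h0 h1).sub (tendsto_variance_bound hd (hcε (-ε)) hp hε)
    rw [sub_zero] at hl
    filter_upwards [hl.eventually (lt_mem_nhds hgε), hlow ε p hε hp, hmG,
      eventually_gt_atTop 0] with n hlt hn hmn hn0
    have hn' : (0 : ℝ) < n := by exact_mod_cast hn0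
    have := binProb_le_unifProb (G := edges d n) (m := m n) (t := n / d * (ε / 4)) (h0 n) (h1 n)
      (by positivity) (by rwa [card_edges]) (by rwa [card_edges]) (hA n)
    rw [card_edges] at this
    linarith
  · have hg' : Tendsto g (𝓝[>] 0) (𝓝 (g 0)) := Tendsto.mono_left hg nhdsWithin_le_nhds
    obtain ⟨ε, hgε, hε⟩ := ((hg'.eventually (gt_mem_nhds ha)).and self_mem_nhdsWithin).exists
    have hε : 0 < ε := hε
    obtain ⟨p, hp, h0, h1⟩ := exists_isThr hd k (hcε ε)
    have hl := (hlim ε p hp h0 h1).add (tendsto_variance_bound hd (hcε ε) hp hε)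
    rw [add_zero] at hl
    filter_upwards [hl.eventually (gt_mem_nhds hgε), hhigh ε p hε hp,
      eventually_gt_atTop 0] with n hlt hn hn0
    have hn' : (0 : ℝ) < n := by exact_mod_cast hn0
    have := unifProb_le_binProb (G := edges d n) (t := n / d * (ε / 4)) (h0 n) (h1 n)
      (by positivity) (by rwa [card_edges]) (hA n)
    rw [card_edges] at this
    linarith

theorem unifProb_le_add {ι : Type*} (G : Finset ι) (m : ℕ) {A B C : Finset ι → Prop}
    (h : ∀ E, A E → B E ∨ C E) : unifProb G m A ≤ unifProb G m B + unifProb G m C := by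
  classical
  rw [unifProb, unifProb, unifProb, ← add_div]
  refine div_le_div_of_nonneg_right ?_ (Nat.cast_nonneg _)
  rw [← Nat.cast_add, Nat.cast_le]
  refine le_trans (card_le_card fun E hE => ?_) (card_union_le _ _)
  obtain ⟨hEm, hEA⟩ := mem_filter.1 hE
  exact mem_union.2 ((h E hEA).imp (fun hB => mem_filter.2 ⟨hEm, hB⟩)
    fun hC => mem_filter.2 ⟨hEm, hC⟩)

end Comparison

end RandomHypergraph

/-! ### Assembly for both models. -/

theorem corollary1p25 (d k : ℕ) (hd : 3 ≤ d) (hk : 1 ≤ k)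
    (c : ℕ → ℝ) (c₀ : ℝ) (hc : Tendsto c atTop (𝓝 c₀)) :
    (∀ m : ℕ → ℕ,
      (∀ᶠ n : ℕ in atTop,
        |(m n : ℝ) - (n : ℝ) / (d : ℝ) *
          (Real.log n + ((k : ℝ) - 1) * Real.log (Real.log n) + c n)| < 1) →
      Tendsto (fun n : ℕ => (uniformModel d n (m n)).real
          {H | H.IsKConnected (k - 1) ∧ ¬ H.IsKConnected (k + 1)}) atTop (𝓝 1) ∧
      Tendsto (fun n : ℕ => (uniformModel d n (m n)).real {H | H.IsKConnected k}) atTop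
          (𝓝 (Real.exp (-(Real.exp (-c₀) / (Nat.factorial (k - 1) : ℝ)))))) ∧
    (∀ p : ℕ → unitInterval,
      (∀ᶠ n : ℕ in atTop,
        (p n : ℝ) = (Nat.factorial (d - 1) : ℝ) *
          ((Real.log n + ((k : ℝ) - 1) * Real.log (Real.log n) + c n) / (n : ℝ) ^ (d - 1))) →
      Tendsto (fun n : ℕ => (binomialModel d n (p n)).real
          {H | H.IsKConnected (k - 1) ∧ ¬ H.IsKConnected (k + 1)}) atTop (𝓝 1) ∧
      Tendsto (fun n : ℕ => (binomialModel d n (p n)).real {H | H.IsKConnected k}) atTop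
          (𝓝 (Real.exp (-(Real.exp (-c₀) / (Nat.factorial (k - 1) : ℝ)))))) := by
  have hd2 : 2 ≤ d := by omega
  refine ⟨fun m hm => ?_, fun p hp => ?_⟩
  · simp only [uniformModel_real]
    have hcε : ∀ ε, Tendsto (fun n => c n + ε) atTop (𝓝 (c₀ + ε)) := fun ε => hc.add_const ε
    have hpred := tendsto_unifProb (k := k) hd2 hc hm (fun n => kConn_mono (n := n) (k - 1))
      (g := fun _ => 1) continuousAt_const
      fun ε p hp h0 h1 => tendsto_binProb_kConn_pred hd2 hk (hcε ε) hp h0 h1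
    have hsucc := tendsto_unifProb (k := k) hd2 hc hm (fun n => kConn_mono (n := n) (k + 1))
      (g := fun _ => 0) continuousAt_const
      fun ε p hp h0 h1 => tendsto_binProb_kConn_succ hd2 (hcε ε) hp h0 h1
    -- Here `g` is the limit as a function of the shift of `c₀`.
    have hmid := tendsto_unifProb (k := k) hd2 hc hm (fun n => kConn_mono (n := n) k)
      (g := fun ε => Real.exp (-(Real.exp (-(c₀ + ε)) / (Nat.factorial (k - 1) : ℝ))))
      (by fun_prop)
      fun ε p hp h0 h1 => tendsto_binProb_kConn hd2 hk (hcε ε) hp h0 h1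
    simp only [add_zero] at hmid
    refine ⟨?_, hmid⟩
    -- The probability of being `(k - 1)`- but not `(k + 1)`-connected is at least the difference of
    -- the two probabilities, which tends to 1 - 0.
    have hlo := hpred.sub hsucc
    rw [sub_zero] at hlo
    refine tendsto_of_tendsto_of_tendsto_of_le_of_le hlo tendsto_const_nhds (fun n => ?_)
      (fun n => unifProb_le_one _ _ _)
    refine sub_le_iff_le_add.2 (unifProb_le_add _ _ fun E h => ?_)
    by_cases hK : KConn (k + 1) E
    · exact Or.inr hK
    · exact Or.inl ⟨h, hK⟩
  · simp only [binomialModel_real]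
    have h0 : ∀ n, 0 ≤ (p n : ℝ) := fun n => (p n).2.1
    have h1 : ∀ n, (p n : ℝ) ≤ 1 := fun n => (p n).2.2
    refine ⟨?_, tendsto_binProb_kConn hd2 hk hc hp h0 h1⟩
    have hlo := (tendsto_binProb_kConn_pred hd2 hk hc hp h0 h1).sub
      (tendsto_binProb_kConn_succ hd2 hc hp h0 h1)
    rw [sub_zero] at hlo
    refine tendsto_of_tendsto_of_tendsto_of_le_of_le hlo tendsto_const_nhds (fun n => ?_)
      (fun n => binProb_le_one (h0 n) (h1 n) _)
    refine sub_le_iff_le_add.2 (binProb_le_add (h0 n) (h1 n) fun E _ h => ?_)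
    by_cases hK : KConn (k + 1) E
    · exact Or.inr hK
    · exact Or.inl ⟨h, hK⟩
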